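/- Let $n\ge 2$ and $0\le i\le n$ be integers with $(n,i)\ne(2,1)$. On $\mathbb{R}^n\times\mathbb{R}^n$ with coordinates $(x,y)$ let $SO(n)$ act diagonally, put $r^2=|x|^2$ and $$\omega_s=\sum_{k=1}^n dx_k\wedge dy_k,\qquad \beta=\sum_{k=1}^n x_k\,dy_k,\qquad \gamma=\sum_{k=1}^n x_k\,dx_k,$$ $$\kappa_i=\frac{1}{i!(n-i)!}\sum_{\pi\in S_n}\operatorname{sign}(\pi)\,dx_{\pi(1)}\cdots dx_{\pi(n-i)}\wedge dy_{\pi(n-i+1)}\cdots dy_{\pi(n)},$$ and, for $0\le j\le n-1$, $$\tau_j=\frac{1}{j!(n-j)!}\sum_{\pi\in S_n}\operatorname{sign}(\pi)\,x_{\pi(1)}\,dx_{\pi(2)}\cdots dx_{\pi(n-j)}\wedge dy_{\pi(n-j+1)}\cdots dy_{\pi(n)},$$ with the convention $\tau_{-1}=\tau_n=0$. Let $\Omega^{n-i}(\mathbb{R}^n)\otimes\Lambda^i\mathbb{R}^n\subset\Omega^n(\mathbb{R}^n\times\mathbb{R}^n)$ be the space of finite linear combinations of the forms $\pi_1^*\eta\wedge\pi_2^*\lambda$,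 where $\eta$ is a smooth $(n-i)$-form on $\mathbb{R}^n$, $\lambda$ is a constant $i$-form on $\mathbb{R}^n$, and $\pi_1,\pi_2$ are the projections onto the two factors. A form $\omega$ is called primitive if $\omega\wedge\omega_s=0$. Theorem. If $\omega\in\Omega^{n-i}(\mathbb{R}^n)\otimes\Lambda^i\mathbb{R}^n$ is primitive and $SO(n)$-invariant, then there exist $c\in\mathbb{R}$ and $\phi_1,\phi_2\in C^\infty([0,\infty))$ such that $$\omega=c\,\kappa_i+\phi_1(r^2)\,\gamma\wedge\tau_i+\phi_2(r^2)\,\beta\wedge\tau_{i-1}\qquad\text{on }\mathbb{R}^n\times\mathbb{R}^n .$$ -/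

import Mathlib

open scoped ContDiff Nat

noncomputable section

namespace InvForms

/-- The phase space `T^*ℝⁿ ≅ ℝⁿ × ℝⁿ`, with points and tangent vectors written `(x, y)`. -/
abbrev Phase (n : ℕ) : Type := EuclideanSpace ℝ (Fin n) × EuclideanSpace ℝ (Fin n)

/-- A position in `Fin d`, `d = a + b`, is one of the first `a` or one of the last `b`. -/
theorem pos_cases {a b d : ℕ} (h : a + b = d) (k : Fin d) :
    (∃ j, k = Fin.cast h (Fin.castAdd b j)) ∨ ∃ j, k = Fin.cast h (Fin.natAdd a j) := by
  subst h
  exact Fin.addCases (fun j => Or.inl ⟨j, rfl⟩) (fun j => Or.inr ⟨j, rfl⟩) k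

section Update

variable {E : Type*} {a b d : ℕ} [DecidableEq (Fin d)] (h : a + b = d) (v : Fin d → E) (z : E)

theorem update_left_left (k : Fin a) :
    (fun j : Fin a => Function.update v (Fin.cast h (Fin.castAdd b k)) z
      (Fin.cast h (Fin.castAdd b j))) =
    Function.update (fun j => v (Fin.cast h (Fin.castAdd b j))) k z := by
  funext j
  by_cases hj : j = k
  · subst hj; simp
  · rw [Function.update_of_ne hj, Function.update_of_ne]
    simpa using hj

theorem update_right_right (k : Fin b) :
    (fun j : Fin b => Function.update v (Fin.cast h (Fin.natAdd a k)) z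
      (Fin.cast h (Fin.natAdd a j))) =
    Function.update (fun j => v (Fin.cast h (Fin.natAdd a j))) k z := by
  funext j
  by_cases hj : j = k
  · subst hj; simp
  · rw [Function.update_of_ne hj, Function.update_of_ne]
    simpa using hj

theorem update_left_right (k : Fin a) :
    (fun j : Fin b => Function.update v (Fin.cast h (Fin.castAdd b k)) z
      (Fin.cast h (Fin.natAdd a j))) =
    fun j => v (Fin.cast h (Fin.natAdd a j)) := by
  funext j
  rw [Function.update_of_ne]
  simp only [ne_eq, Fin.ext_iff, Fin.val_cast, Fin.val_natAdd, Fin.val_castAdd]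
  omega

theorem update_right_left (k : Fin b) :
    (fun j : Fin a => Function.update v (Fin.cast h (Fin.natAdd a k)) z
      (Fin.cast h (Fin.castAdd b j))) =
    fun j => v (Fin.cast h (Fin.castAdd b j)) := by
  funext j
  rw [Function.update_of_ne]
  simp only [ne_eq, Fin.ext_iff, Fin.val_cast, Fin.val_natAdd, Fin.val_castAdd]
  omega

end Update

section Wedge

variable {E : Type*} [NormedAddCommGroup E] [NormedSpace ℝ E]

/-- The tensor product `α ⊗ β` of two alternating forms, as a multilinear form:
`(v₁, …, v_d) ↦ α (v₁, …, v_a) * β (v_{a+1}, …, v_d)`, where `d = a + b`. -/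
def tensor {a b d : ℕ} (h : a + b = d) (α : E [⋀^Fin a]→L[ℝ] ℝ) (β : E [⋀^Fin b]→L[ℝ] ℝ) :
    ContinuousMultilinearMap ℝ (fun _ : Fin d => E) ℝ where
  toFun v := α (fun j => v (Fin.cast h (Fin.castAdd b j))) *
    β (fun j => v (Fin.cast h (Fin.natAdd a j)))
  map_update_add' := by
    intro _ v k x y
    obtain ⟨k', rfl⟩ | ⟨k', rfl⟩ := pos_cases h k
    · simp only [update_left_left, update_left_right, ContinuousAlternatingMap.map_update_add,
        add_mul]
    · simp only [update_right_left, update_right_right, ContinuousAlternatingMap.map_update_add,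
        mul_add]
  map_update_smul' := by
    intro _ v k c x
    obtain ⟨k', rfl⟩ | ⟨k', rfl⟩ := pos_cases h k
    · simp only [update_left_left, update_left_right, ContinuousAlternatingMap.map_update_smul,
        smul_eq_mul, mul_assoc]
    · simp only [update_right_left, update_right_right, ContinuousAlternatingMap.map_update_smul,
        smul_eq_mul, mul_left_comm]
  cont := by
    refine (α.coe_continuous.comp ?_).mul (β.coe_continuous.comp ?_) <;> fun_prop

/-- The exterior product `α ∧ β = (1 / (a! b!)) Alt (α ⊗ β)` of an `a`-form and a `b`-form; the
equation `h` records the degree of the product. -/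
def wedge {a b d : ℕ} (h : a + b = d) (α : E [⋀^Fin a]→L[ℝ] ℝ) (β : E [⋀^Fin b]→L[ℝ] ℝ) :
    E [⋀^Fin d]→L[ℝ] ℝ :=
  ((a ! : ℝ) * (b ! : ℝ))⁻¹ • ContinuousMultilinearMap.alternatization (tensor h α β)

/-- A covector as an alternating form of degree one. -/
def oneForm (l : E →L[ℝ] ℝ) : E [⋀^Fin 1]→L[ℝ] ℝ :=
  ContinuousAlternatingMap.ofSubsingleton ℝ E ℝ (0 : Fin 1) l

/-- The exterior product `l₁ ∧ … ∧ l_k` of covectors,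
`(v₁, …, v_k) ↦ ∑ σ, sign σ * ∏ j, l_j (v_{σ j}) = det (l_a (v_b))`. -/
def covWedge {k : ℕ} (l : Fin k → E →L[ℝ] ℝ) : E [⋀^Fin k]→L[ℝ] ℝ :=
  ContinuousMultilinearMap.alternatization
    ((ContinuousMultilinearMap.mkPiAlgebra ℝ (Fin k) ℝ).compContinuousLinearMap l)

end Wedge

/-- The covector `dx_k` on `ℝⁿ × ℝⁿ`. -/
def dx {n : ℕ} (k : Fin n) : Phase n →L[ℝ] ℝ :=
  (EuclideanSpace.proj k).comp (ContinuousLinearMap.fst ℝ _ _)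

/-- The covector `dy_k` on `ℝⁿ × ℝⁿ`. -/
def dy {n : ℕ} (k : Fin n) : Phase n →L[ℝ] ℝ :=
  (EuclideanSpace.proj k).comp (ContinuousLinearMap.snd ℝ _ _)

/-- The symplectic form `ω_s = ∑ k, dx_k ∧ dy_k`. -/
def sympForm (n : ℕ) : Phase n [⋀^Fin 2]→L[ℝ] ℝ :=
  ∑ k : Fin n, covWedge ![dx k, dy k]

/-- The one-form `β = ∑ k, x_k dy_k`. -/
def betaForm {n : ℕ} (p : Phase n) : Phase n [⋀^Fin 1]→L[ℝ] ℝ :=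
  ∑ k : Fin n, p.1 k • oneForm (dy k)

/-- The one-form `γ = ∑ k, x_k dx_k`. -/
def gammaForm {n : ℕ} (p : Phase n) : Phase n [⋀^Fin 1]→L[ℝ] ℝ :=
  ∑ k : Fin n, p.1 k • oneForm (dx k)

/-- The constant `n`-form
`κ_i = 1 / (i! (n-i)!) ∑ π, sign π dx_{π 1} … dx_{π (n-i)} ∧ dy_{π (n-i+1)} … dy_{π n}`
for `0 ≤ i ≤ n` (positions are counted from `0` in the code). -/
def kappaForm (n i : ℕ) : Phase n [⋀^Fin n]→L[ℝ] ℝ :=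
  ((i ! : ℝ) * ((n - i)! : ℝ))⁻¹ • ∑ π : Equiv.Perm (Fin n), ((Equiv.Perm.sign π : ℤ) : ℝ) •
    covWedge (fun j : Fin n => if (j : ℕ) < n - i then dx (π j) else dy (π j))

/-- The `(n-1)`-form
`τ_i = 1 / (i! (n-i)!) ∑ π, sign π x_{π 1} dx_{π 2} … dx_{π (n-i)} ∧ dy_{π (n-i+1)} … dy_{π n}`
for `0 ≤ i ≤ n - 1`; outside this range, that is for `τ_{-1}` and `τ_n`, it is zero. Position
`j` of the product (counted from `0`) carries the index `π (j + 1)`. -/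
def tauForm {n : ℕ} (hn : 0 < n) (i : ℤ) (p : Phase n) : Phase n [⋀^Fin (n - 1)]→L[ℝ] ℝ :=
  if 0 ≤ i ∧ i < n then
    ((i.toNat ! : ℝ) * ((n - i.toNat)! : ℝ))⁻¹ •
      ∑ π : Equiv.Perm (Fin n), (((Equiv.Perm.sign π : ℤ) : ℝ) * p.1 (π ⟨0, hn⟩)) •
        covWedge (fun j : Fin (n - 1) =>
          if (j : ℕ) + 1 < n - i.toNat then dx (π ⟨j + 1, by omega⟩)
          else dy (π ⟨j + 1, by omega⟩))
  else 0

/-- `Ω^a(ℝⁿ) ⊗ Λ^b ℝⁿ` as a space of `d`-forms on `ℝⁿ × ℝⁿ`, `d = a + b`: the linear span of the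
forms `π₁^* η ∧ π₂^* l`, where `η` is a smooth `a`-form on `ℝⁿ`, `l` is a constant `b`-form on
`ℝⁿ`, and `π₁`, `π₂` are the projections onto the two factors. -/
def mixedForms (n : ℕ) {a b d : ℕ} (h : a + b = d) :
    Submodule ℝ (Phase n → Phase n [⋀^Fin d]→L[ℝ] ℝ) :=
  Submodule.span ℝ
    {w | ∃ (η : EuclideanSpace ℝ (Fin n) → EuclideanSpace ℝ (Fin n) [⋀^Fin a]→L[ℝ] ℝ)
        (l : EuclideanSpace ℝ (Fin n) [⋀^Fin b]→L[ℝ] ℝ), ContDiff ℝ ∞ η ∧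
        w = fun p => wedge h
          ((η p.1).compContinuousLinearMap (ContinuousLinearMap.fst ℝ _ _))
          (l.compContinuousLinearMap (ContinuousLinearMap.snd ℝ _ _))}

/-- `w` is primitive: `w ∧ ω_s = 0` at every point. -/
def IsPrimitive {n d : ℕ} (w : Phase n → Phase n [⋀^Fin d]→L[ℝ] ℝ) : Prop :=
  ∀ p, wedge (rfl : d + 2 = d + 2) (w p) (sympForm n) = 0

/-- The diagonal action `(x, y) ↦ (g x, g y)` of a matrix on `ℝⁿ × ℝⁿ`. -/
def diagAct {n : ℕ} (g : Matrix (Fin n) (Fin n) ℝ) : Phase n →L[ℝ] Phase n :=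
  (Matrix.toEuclideanCLM (n := Fin n) (𝕜 := ℝ) g).prodMap
    (Matrix.toEuclideanCLM (n := Fin n) (𝕜 := ℝ) g)

/-- `w` is `SO(n)`-invariant: `g^* w = w` for all `g ∈ SO(n)`. -/
def IsSOInvariant {n d : ℕ} (w : Phase n → Phase n [⋀^Fin d]→L[ℝ] ℝ) : Prop :=
  ∀ g ∈ Matrix.specialOrthogonalGroup (Fin n) ℝ, ∀ p,
    (w (diagAct g p)).compContinuousLinearMap (diagAct g) = w p

end InvForms

end

/-!
The forms that occur are determined by their values on frames of coordinate vectors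
`basisVec t k` (`∂/∂x_k` or `∂/∂y_k`, according to the type `t`), and by invariance it is enough to
compare both sides at the points `r e_0` of one axis (`exists_rotation_to_axis`). Of the stabilizer
`SO(n-1)` of such a point only the signed permutation matrices are used (`IsFixedBySigned`); they
replace the first fundamental theorem of invariant theory.

* Frames in which some index is repeated: the value of `w` is zero
  (`apply_eq_zero_of_not_injective`). If the frame omits an index `c` other than that of the axis,
  extend it by `∂/∂x_c, ∂/∂y_c` and evaluate `w ∧ ω_s = 0` there. Every contraction with a
  conjugate pair off the axis gives the same value, since a signed permutation in `SO(n)` exchanges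
  the pair with the new one, and a pair on the axis contributes zero, so a positive multiple of the
  value of `w` vanishes (`apply_eq_zero_of_primitive_of_missing`). What is excluded in this way are
  the powers of the symplectic form of the orthogonal complement of the axis. If only the axis
  direction is omitted, a change of two signs gives the claim, except for `(n, i) = (2, 1)`. The
  model forms vanish on frames with a repeated index because they are alternations of determinants
  (`alternant_apply`, `radialWedge_apply`).
* Frames with pairwise distinct indices: after reordering, the value depends only on the number of
  `y`-directions, which is `i`, and on the type of `e_0` (`IsFixedBySigned.typeFrame_eq`). Thus `w`
  has at most two free coefficients at each radius. `γ ∧ τ_i` and `β ∧ τ_{i-1}` each detect one of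
  them with a positive multiple of `r²` (`IsRadialModel`). At the origin all of `SO(n)` acts, the two
  coefficients of `w` agree, and their common value is that of a multiple of `κ_i`.

Each coefficient of `w` is smooth and even in `r`. By Whitney's theorem on even functions, it is its
value at `0` plus `r² f(r²)` with `f` smooth on `[0, ∞)` (`exists_eq_add_sq_mul_of_even`), and this
`f` gives the function `φ₁` or `φ₂` up to a constant factor.
-/

noncomputable section

namespace InvForms

/-! ### Smooth even functions of one variable -/

theorem hasDerivAt_integral_mul_comp_mul {f G : ℝ → ℝ} (hf : Continuous f)
    (hG : ContDiff ℝ 1 G) (r : ℝ) :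
    HasDerivAt (fun r => ∫ t in (0 : ℝ)..1, f t * G (t * r))
      (∫ t in (0 : ℝ)..1, (f t * t) * deriv G (t * r)) r := by
  have hG' : Continuous (deriv G) := hG.continuous_deriv le_rfl
  have hGc : Continuous G := hG.continuous
  obtain ⟨C, hC⟩ := (isCompact_Icc (a := -(|r| + 1)) (b := |r| + 1)).exists_bound_of_continuousOn
    hG'.continuousOn
  refine (intervalIntegral.hasDerivAt_integral_of_dominated_loc_of_deriv_le
    (F := fun r t => f t * G (t * r)) (F' := fun r t => (f t * t) * deriv G (t * r))
    (bound := fun t => |f t * t| * C) (s := Metric.ball r 1)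
    (Metric.ball_mem_nhds r one_pos) ?_ ?_ ?_ ?_ ?_ ?_).2
  · exact .of_forall fun x => Continuous.aestronglyMeasurable (by fun_prop)
  · exact Continuous.intervalIntegrable (by fun_prop) _ _
  · exact Continuous.aestronglyMeasurable (by fun_prop)
  · refine .of_forall fun t ht x hx => ?_
    rw [Set.uIoc_of_le zero_le_one] at ht
    rw [norm_mul, Real.norm_eq_abs]
    refine mul_le_mul_of_nonneg_left (hC _ ?_) (abs_nonneg _)
    rw [Metric.mem_ball, Real.dist_eq] at hx
    have h1 : |t * x| ≤ |r| + 1 := by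
      rw [abs_mul, abs_of_pos ht.1]
      have h2 : |x| ≤ |r| + 1 := by
        have := abs_sub_abs_le_abs_sub x r
        linarith
      nlinarith [abs_nonneg x, ht.1, ht.2]
    exact abs_le.1 h1
  · exact Continuous.intervalIntegrable (by fun_prop) _ _
  · refine .of_forall fun t _ x _ => ?_
    have h1 : HasDerivAt G (deriv G (t * x)) (t * x) :=
      ((hG.differentiable one_ne_zero) _).hasDerivAt
    have h2 : HasDerivAt (fun x : ℝ => t * x) t x := by
      simpa using (hasDerivAt_id x).const_mul t
    have := (h1.comp x h2).const_mul (f t)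
    exact this.congr_deriv (by ring)

theorem contDiff_integral_mul_comp_mul {f G : ℝ → ℝ} (hf : Continuous f) (hG : ContDiff ℝ ∞ G) :
    ContDiff ℝ ∞ (fun r => ∫ t in (0 : ℝ)..1, f t * G (t * r)) := by
  rw [contDiff_infty]
  intro k
  induction k generalizing f G with
  | zero =>
    exact contDiff_zero.2 (continuous_iff_continuousAt.2 fun r =>
      (hasDerivAt_integral_mul_comp_mul hf (hG.of_le (by simp)) r).continuousAt)
  | succ k ih =>
    have hd := fun r => hasDerivAt_integral_mul_comp_mul hf (hG.of_le (by simp)) r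
    push_cast
    refine contDiff_succ_iff_deriv.2 ⟨fun r => (hd r).differentiableAt, by simp, ?_⟩
    rw [funext fun r => (hd r).deriv]
    exact ih (by fun_prop) (contDiff_infty_iff_deriv.1 hG).2

/-- Hadamard's lemma in one variable. -/
theorem eq_add_mul_integral_deriv {F : ℝ → ℝ} (hF : ContDiff ℝ 1 F) (r : ℝ) :
    F r = F 0 + r * ∫ t in (0 : ℝ)..1, deriv F (t * r) := by
  rw [intervalIntegral.mul_integral_comp_mul_right,
    intervalIntegral.integral_deriv_eq_sub (fun x _ => (hF.differentiable one_ne_zero) x)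
      ((hF.continuous_deriv le_rfl).intervalIntegrable _ _)]
  simp

theorem deriv_neg_of_even {F : ℝ → ℝ} (he : ∀ r, F (-r) = F r) (r : ℝ) :
    deriv F (-r) = -deriv F r := by
  have h : deriv (fun x => F (-x)) r = -deriv F (-r) := deriv_comp_neg F r
  rw [funext he] at h
  rw [h, neg_neg]

theorem deriv_neg_of_odd {F : ℝ → ℝ} (he : ∀ r, F (-r) = -F r) (r : ℝ) :
    deriv F (-r) = deriv F r := by
  have h : deriv (fun x => F (-x)) r = -deriv F (-r) := deriv_comp_neg F r
  rw [funext he, deriv.fun_neg] at h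
  linarith

/-- The derivative of a smooth even function is `r` times a smooth even function. -/
theorem exists_deriv_eq_mul_of_even {F : ℝ → ℝ} (hF : ContDiff ℝ ∞ F) (he : ∀ r, F (-r) = F r) :
    ∃ H : ℝ → ℝ, ContDiff ℝ ∞ H ∧ (∀ r, H (-r) = H r) ∧ ∀ r, deriv F r = r * H r := by
  have hF' := (contDiff_infty_iff_deriv.1 hF).2
  have hF'' := (contDiff_infty_iff_deriv.1 hF').2
  have h0 : deriv F 0 = 0 := by
    have := deriv_neg_of_even he 0
    rw [neg_zero] at this
    linarith
  refine ⟨fun r => ∫ t in (0 : ℝ)..1, deriv (deriv F) (t * r), ?_, fun r => ?_, fun r => ?_⟩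
  · simpa using contDiff_integral_mul_comp_mul (f := fun _ => 1) continuous_const hF''
  · simp only [mul_neg, deriv_neg_of_odd (deriv_neg_of_even he)]
  · rw [eq_add_mul_integral_deriv (hF'.of_le (by simp)) r, h0, zero_add]

/-- Whitney: a smooth even function is a smooth function of the square of its argument, up to the
boundary. -/
theorem contDiffOn_comp_sqrt_of_even {F : ℝ → ℝ} (hF : ContDiff ℝ ∞ F)
    (he : ∀ r, F (-r) = F r) : ContDiffOn ℝ ∞ (fun s => F (√s)) (Set.Ici 0) := by
  rw [contDiffOn_infty]
  intro k
  induction k generalizing F with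
  | zero =>
    exact contDiffOn_zero.2 (hF.continuous.comp Real.continuous_sqrt).continuousOn
  | succ k ih =>
    obtain ⟨H, hH, hHe, hFH⟩ := exists_deriv_eq_mul_of_even hF he
    have hpos : ∀ s : ℝ, 0 < s → HasDerivAt (fun s => F (√s)) (2⁻¹ * H (√s)) s := by
      intro s hs
      have h1 : HasDerivAt F (√s * H (√s)) (√s) := by
        rw [← hFH]
        exact ((hF.differentiable (by simp)) _).hasDerivAt
      have h2 := h1.comp s (Real.hasDerivAt_sqrt hs.ne')
      have h3 : √s ≠ 0 := (Real.sqrt_pos.2 hs).ne'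
      refine h2.congr_deriv ?_
      field_simp
    have hcont : Continuous fun s => F (√s) := hF.continuous.comp Real.continuous_sqrt
    have hHcont : Continuous fun s => 2⁻¹ * H (√s) :=
      continuous_const.mul (hH.continuous.comp Real.continuous_sqrt)
    -- at the boundary point the derivative is the limit of the derivatives
    have hd : ∀ s ∈ Set.Ici (0 : ℝ),
        HasDerivWithinAt (fun s => F (√s)) (2⁻¹ * H (√s)) (Set.Ici 0) s := by
      intro s hs
      rcases eq_or_lt_of_le (Set.mem_Ici.1 hs) with rfl | hs
      · refine hasDerivWithinAt_Ici_of_tendsto_deriv (s := Set.Ioi 0)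
          (fun s hs => (hpos s hs).differentiableAt.differentiableWithinAt)
          hcont.continuousWithinAt self_mem_nhdsWithin ?_
        refine Filter.Tendsto.congr' ?_ (hHcont.continuousWithinAt (s := Set.Ioi 0) (x := 0))
        filter_upwards [self_mem_nhdsWithin] with s hs using (hpos s hs).deriv.symm
      · exact (hpos s hs).hasDerivWithinAt
    push_cast
    refine (contDiffOn_succ_iff_derivWithin (uniqueDiffOn_Ici 0)).2
      ⟨fun s hs => (hd s hs).differentiableWithinAt, by simp, ?_⟩
    refine ((contDiffOn_const (c := (2⁻¹ : ℝ))).mul (ih hH hHe)).congr fun s hs => ?_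
    exact (hd s hs).derivWithin (uniqueDiffOn_Ici 0 s hs)

theorem exists_eq_add_sq_mul_of_even {F : ℝ → ℝ} (hF : ContDiff ℝ ∞ F)
    (he : ∀ r, F (-r) = F r) :
    ∃ f : ℝ → ℝ, ContDiffOn ℝ ∞ f (Set.Ici 0) ∧ ∀ r, 0 ≤ r → F r = F 0 + r ^ 2 * f (r ^ 2) := by
  obtain ⟨H, hH, hHe, hFH⟩ := exists_deriv_eq_mul_of_even hF he
  let L : ℝ → ℝ := fun r => ∫ t in (0 : ℝ)..1, t * H (t * r)
  have hL : ContDiff ℝ ∞ L := contDiff_integral_mul_comp_mul continuous_id hH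
  have hLe : ∀ r, L (-r) = L r := fun r => by simp only [L, mul_neg, hHe]
  refine ⟨fun s => L (√s), contDiffOn_comp_sqrt_of_even hL hLe, fun r hr => ?_⟩
  simp only [Real.sqrt_sq hr]
  rw [eq_add_mul_integral_deriv (hF.of_le (by simp)) r]
  simp only [hFH, L]
  have h : ∀ t, t * r * H (t * r) = r * (t * H (t * r)) := fun t => by ring
  simp only [h, intervalIntegral.integral_const_mul]
  ring

/-! ### Evaluation of forms, coordinate vectors and signed permutations -/

section Eval

variable {E : Type*} [NormedAddCommGroup E] [NormedSpace ℝ E]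

theorem tensor_apply {a b d : ℕ} (h : a + b = d) (α : E [⋀^Fin a]→L[ℝ] ℝ)
    (β : E [⋀^Fin b]→L[ℝ] ℝ) (v : Fin d → E) :
    tensor h α β v = α (fun j => v (Fin.cast h (Fin.castAdd b j))) *
      β (fun j => v (Fin.cast h (Fin.natAdd a j))) := rfl

theorem wedge_apply {a b d : ℕ} (h : a + b = d) (α : E [⋀^Fin a]→L[ℝ] ℝ)
    (β : E [⋀^Fin b]→L[ℝ] ℝ) (v : Fin d → E) :
    wedge h α β v = ((a ! : ℝ) * (b ! : ℝ))⁻¹ * ∑ σ : Equiv.Perm (Fin d),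
      ((Equiv.Perm.sign σ : ℤ) : ℝ) * tensor h α β (v ∘ σ) := by
  simp [wedge, ContinuousMultilinearMap.alternatization_apply_apply, Units.smul_def]

theorem covWedge_apply {k : ℕ} (l : Fin k → E →L[ℝ] ℝ) (v : Fin k → E) :
    covWedge l v = ∑ σ : Equiv.Perm (Fin k),
      ((Equiv.Perm.sign σ : ℤ) : ℝ) * ∏ j, l j (v (σ j)) := by
  simp [covWedge, ContinuousMultilinearMap.alternatization_apply_apply, Units.smul_def]

theorem oneForm_apply (l : E →L[ℝ] ℝ) (v : Fin 1 → E) : oneForm l v = l (v 0) := by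
  simp [oneForm]

theorem wedge_zero {a b d : ℕ} (h : a + b = d) (α : E [⋀^Fin a]→L[ℝ] ℝ) :
    wedge h α (0 : E [⋀^Fin b]→L[ℝ] ℝ) = 0 := by
  ext v
  simp [wedge_apply, tensor_apply]

end Eval

/-- The coordinate vectors of `ℝⁿ × ℝⁿ`: `∂/∂x_k` for `t = false` and `∂/∂y_k` for `t = true`. -/
def basisVec {n : ℕ} (t : Bool) (k : Fin n) : Phase n :=
  if t then (0, EuclideanSpace.single k 1) else (EuclideanSpace.single k 1, 0)

/-- The projection of `ℝⁿ × ℝⁿ` onto its first (`t = false`) or second (`t = true`) factor. -/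
def proj {n : ℕ} (t : Bool) : Phase n →L[ℝ] EuclideanSpace ℝ (Fin n) :=
  if t then ContinuousLinearMap.snd ℝ _ _ else ContinuousLinearMap.fst ℝ _ _

theorem proj_basisVec {n : ℕ} (s t : Bool) (k : Fin n) :
    proj s (basisVec t k) = (if t = s then (1 : ℝ) else 0) • EuclideanSpace.single k (1 : ℝ) := by
  cases s <;> cases t <;> simp [proj, basisVec]

theorem ext_basisVec {n d : ℕ} {α β : Phase n [⋀^Fin d]→L[ℝ] ℝ}
    (h : ∀ (t : Fin d → Bool) (k : Fin d → Fin n),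
      α (fun j => basisVec (t j) (k j)) = β (fun j => basisVec (t j) (k j))) : α = β := by
  apply ContinuousAlternatingMap.toAlternatingMap_injective
  let e := ((EuclideanSpace.basisFun (Fin n) ℝ).toBasis).prod
    ((EuclideanSpace.basisFun (Fin n) ℝ).toBasis)
  have he : ∀ u, e u = basisVec (Sum.isRight u) (Sum.elim id id u) := by
    rintro (u | u) <;> simp [e, basisVec]
  refine Module.Basis.ext_alternating e fun u _ => ?_
  simp only [he]
  exact h _ _

theorem map_eq_zero_of_eq_basisVec {n d : ℕ} (α : Phase n [⋀^Fin d]→L[ℝ] ℝ) {t : Fin d → Bool}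
    {k : Fin d → Fin n} {a b : Fin d} (ht : t a = t b) (hk : k a = k b) (hab : a ≠ b) :
    α (fun j => basisVec (t j) (k j)) = 0 :=
  α.map_eq_zero_of_eq _ (by simp [ht, hk]) hab

/-- The signed permutation matrix `e_k ↦ ε_k e_{ρ k}`. -/
def signedPerm {n : ℕ} (ρ : Equiv.Perm (Fin n)) (ε : Fin n → ℝ) : Matrix (Fin n) (Fin n) ℝ :=
  Matrix.of fun a k => if a = ρ k then ε k else 0

theorem signedPerm_mulVec_single {n : ℕ} (ρ : Equiv.Perm (Fin n)) (ε : Fin n → ℝ) (k : Fin n) :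
    (signedPerm ρ ε).mulVec (Pi.single k 1) = ε k • Pi.single (ρ k) 1 := by
  ext a
  simp [signedPerm, Matrix.mulVec_single, Pi.single_apply]

theorem signedPerm_mem {n : ℕ} {ρ : Equiv.Perm (Fin n)} {ε : Fin n → ℝ}
    (hε : ∀ k, ε k * ε k = 1) (hdet : (∏ k, ε k) * ((Equiv.Perm.sign ρ : ℤ) : ℝ) = 1) :
    signedPerm ρ ε ∈ Matrix.specialOrthogonalGroup (Fin n) ℝ := by
  rw [Matrix.mem_specialOrthogonalGroup_iff, Matrix.mem_orthogonalGroup_iff']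
  constructor
  · ext a b
    simp only [signedPerm, Matrix.mul_apply, Matrix.transpose_apply, Matrix.of_apply,
      Matrix.one_apply, mul_ite, mul_zero, ite_mul, zero_mul]
    simp only [Finset.sum_ite_eq', Finset.mem_univ, if_true, EmbeddingLike.apply_eq_iff_eq]
    by_cases hab : a = b
    · subst hab; simp [hε]
    · simp [hab, Ne.symm hab]
  · have h : signedPerm ρ ε = (ρ⁻¹ : Equiv.Perm (Fin n)).permMatrix ℝ * Matrix.diagonal ε := by
      ext a b
      simp only [signedPerm, Matrix.of_apply, Matrix.mul_diagonal, Equiv.Perm.permMatrix,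
        PEquiv.toMatrix_apply, Equiv.toPEquiv_apply, Option.mem_def, Option.some.injEq,
        Equiv.Perm.inv_eq_iff_eq, ite_mul, one_mul, zero_mul]
    rw [h, Matrix.det_mul, Matrix.det_permutation, Matrix.det_diagonal, mul_comm,
      Equiv.Perm.sign_inv]
    exact hdet

theorem proj_diagAct {n : ℕ} (s : Bool) (g : Matrix (Fin n) (Fin n) ℝ) (p : Phase n) :
    proj s (diagAct g p) = Matrix.toEuclideanCLM (n := Fin n) (𝕜 := ℝ) g (proj s p) := by
  cases s <;> simp [proj, diagAct]

theorem diagAct_signedPerm_basisVec {n : ℕ} (ρ : Equiv.Perm (Fin n)) (ε : Fin n → ℝ)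
    (t : Bool) (k : Fin n) :
    diagAct (signedPerm ρ ε) (basisVec t k) = ε k • basisVec t (ρ k) := by
  have h : Matrix.toEuclideanCLM (n := Fin n) (𝕜 := ℝ) (signedPerm ρ ε)
      (EuclideanSpace.single k 1) = ε k • EuclideanSpace.single (ρ k) 1 := by
    apply PiLp.ext
    intro a
    have := congrFun (signedPerm_mulVec_single ρ ε k) a
    rw [Matrix.ofLp_toEuclideanCLM]
    simpa [Pi.single_apply] using this
  cases t <;> simp [diagAct, basisVec, h]

/-- The form `α` is fixed by every signed permutation in `SO(n)` that fixes the vector `e_z`;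
this is all that is needed of the stabilizer of a point on the axis of `e_z`. -/
def IsFixedBySigned {n : ℕ} (z : Fin n) (α : Phase n [⋀^Fin n]→L[ℝ] ℝ) : Prop :=
  ∀ (ρ : Equiv.Perm (Fin n)) (ε : Fin n → ℝ), (∀ k, ε k * ε k = 1) →
    (∏ k, ε k) * ((Equiv.Perm.sign ρ : ℤ) : ℝ) = 1 → ρ z = z → ε z = 1 →
    α.compContinuousLinearMap (diagAct (signedPerm ρ ε)) = α

theorem apply_signedPerm {n d : ℕ} {α β : Phase n [⋀^Fin d]→L[ℝ] ℝ} {ρ : Equiv.Perm (Fin n)}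
    {ε : Fin n → ℝ} (h : β.compContinuousLinearMap (diagAct (signedPerm ρ ε)) = α)
    (t : Fin d → Bool) (k : Fin d → Fin n) :
    α (fun j => basisVec (t j) (k j)) =
      (∏ j, ε (k j)) * β (fun j => basisVec (t j) (ρ (k j))) := by
  rw [← h, ContinuousAlternatingMap.compContinuousLinearMap_apply]
  simp only [Function.comp_def, diagAct_signedPerm_basisVec]
  rw [← smul_eq_mul]
  exact β.toMultilinearMap.map_smul_univ _ _

/-- The frame with one coordinate vector for each index `k`, of type prescribed by `t`. -/
abbrev typeFrame {n : ℕ} (t : Fin n → Bool) : Fin n → Phase n := fun k => basisVec (t k) k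

/-- Reordering reduces the evaluation on a frame with pairwise distinct indices to a
`typeFrame`. -/
theorem apply_perm_eq {n : ℕ} (α : Phase n [⋀^Fin n]→L[ℝ] ℝ) (t : Fin n → Bool)
    (π : Equiv.Perm (Fin n)) :
    α (fun j => basisVec (t j) (π j)) =
      ((Equiv.Perm.sign π : ℤ) : ℝ) * α (typeFrame (t ∘ π.symm)) := by
  have h := α.toAlternatingMap.map_perm (typeFrame (t ∘ π.symm)) π
  have h2 : (typeFrame (t ∘ π.symm)) ∘ π = fun j => basisVec (t j) (π j) := by
    ext j : 1
    simp [typeFrame]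
  rw [h2] at h
  simpa [Units.smul_def] using h

/-! ### Invariant forms on frames with distinct indices -/

/-- The number of `y`-directions in a type pattern. -/
def typeCount {d : ℕ} (t : Fin d → Bool) : ℕ := Fintype.card {j // t j = true}

theorem typeCount_comp {d : ℕ} (t : Fin d → Bool) (σ : Equiv.Perm (Fin d)) :
    typeCount (t ∘ σ) = typeCount t :=
  Fintype.card_congr (σ.subtypeEquiv fun _ => Iff.rfl)

/-- The form `α` vanishes on frames of coordinate vectors that do not contain exactly `i`
vectors in `y`-directions. -/
def HasBidegree {n d : ℕ} (α : Phase n [⋀^Fin d]→L[ℝ] ℝ) (i : ℕ) : Prop :=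
  ∀ (t : Fin d → Bool) (k : Fin d → Fin n),
    α (fun j => basisVec (t j) (k j)) ≠ 0 → typeCount t = i

theorem exists_perm_comp_eq {d : ℕ} {t t' : Fin d → Bool} (h : typeCount t = typeCount t') :
    ∃ ρ : Equiv.Perm (Fin d), t ∘ ρ = t' := by
  let e : {j // t' j = true} ≃ {j // t j = true} := Fintype.equivOfCardEq h.symm
  refine ⟨e.extendSubtype, funext fun j => ?_⟩
  by_cases hj : t' j = true
  · simpa [hj] using e.extendSubtype_mem j hj
  · have := e.extendSubtype_not_mem j hj
    simp only [Bool.not_eq_true] at hj this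
    simp [hj, this]

theorem exists_perm_comp_eq_of_apply_eq {d : ℕ} {t t' : Fin d → Bool}
    (h : typeCount t = typeCount t') {z : Fin d} (hz : t z = t' z) :
    ∃ ρ : Equiv.Perm (Fin d), t ∘ ρ = t' ∧ ρ z = z := by
  obtain ⟨ρ, hρ⟩ := exists_perm_comp_eq h
  have h1 : t (ρ z) = t z := by rw [hz, ← hρ]; rfl
  refine ⟨Equiv.swap z (ρ z) * ρ, funext fun j => ?_, by simp⟩
  rw [← hρ]
  simp only [Function.comp_apply, Equiv.Perm.mul_apply]
  by_cases hj : ρ j = z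
  · rw [hj, Equiv.swap_apply_left, h1]
  by_cases hj' : ρ j = ρ z
  · rw [hj', Equiv.swap_apply_right, h1]
  · rw [Equiv.swap_apply_of_ne_of_ne hj hj']

theorem sign_mul_self_cast {d : ℕ} (ρ : Equiv.Perm (Fin d)) :
    ((Equiv.Perm.sign ρ : ℤ) : ℝ) * ((Equiv.Perm.sign ρ : ℤ) : ℝ) = 1 := by
  rcases Int.units_eq_one_or (Equiv.Perm.sign ρ) with h | h <;> simp [h]

/-- The signs of a signed permutation matrix over `ρ` of determinant one; the sign of `ρ` is
compensated at the index `c`. -/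
def fixSign {n : ℕ} (ρ : Equiv.Perm (Fin n)) (c : Fin n) : Fin n → ℝ :=
  fun k => if k = c then ((Equiv.Perm.sign ρ : ℤ) : ℝ) else 1

theorem fixSign_mul_self {n : ℕ} (ρ : Equiv.Perm (Fin n)) (c k : Fin n) :
    fixSign ρ c k * fixSign ρ c k = 1 := by
  unfold fixSign
  split_ifs
  · exact sign_mul_self_cast ρ
  · simp

theorem prod_fixSign {n : ℕ} (ρ : Equiv.Perm (Fin n)) (c : Fin n) :
    ∏ k, fixSign ρ c k = ((Equiv.Perm.sign ρ : ℤ) : ℝ) := by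
  simp [fixSign]

theorem fixSign_mem {n : ℕ} (ρ : Equiv.Perm (Fin n)) (c : Fin n) :
    signedPerm ρ (fixSign ρ c) ∈ Matrix.specialOrthogonalGroup (Fin n) ℝ :=
  signedPerm_mem (fixSign_mul_self ρ c) (by rw [prod_fixSign, sign_mul_self_cast])

theorem typeFrame_comp_of_fixed {n : ℕ} {α β : Phase n [⋀^Fin n]→L[ℝ] ℝ}
    {ρ : Equiv.Perm (Fin n)} {ε : Fin n → ℝ}
    (hdet : (∏ k, ε k) * ((Equiv.Perm.sign ρ : ℤ) : ℝ) = 1)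
    (h : β.compContinuousLinearMap (diagAct (signedPerm ρ ε)) = α) (t : Fin n → Bool) :
    α (typeFrame (t ∘ ρ)) = β (typeFrame t) := by
  have h1 := apply_signedPerm h (t ∘ ρ) id
  have h2 := apply_perm_eq β (t ∘ ρ) ρ
  simp only [id] at h1
  rw [show (t ∘ ρ) ∘ ρ.symm = t by ext; simp] at h2
  rw [h2, ← mul_assoc, hdet, one_mul] at h1
  exact h1

/-- A form fixed by the stabilizer of `e_z` has a value on a `typeFrame` that depends only on the
type of `e_z` and on the number of `y`-directions. -/
theorem IsFixedBySigned.typeFrame_eq {n : ℕ} (hn : 2 ≤ n) {z : Fin n}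
    {α : Phase n [⋀^Fin n]→L[ℝ] ℝ} (h : IsFixedBySigned z α) {t t' : Fin n → Bool}
    (hc : typeCount t = typeCount t') (hz : t z = t' z) :
    α (typeFrame t) = α (typeFrame t') := by
  obtain ⟨ρ, rfl, hρz⟩ := exists_perm_comp_eq_of_apply_eq hc hz
  have : Nontrivial (Fin n) := Fin.nontrivial_iff_two_le.2 hn
  obtain ⟨c, hcz⟩ := exists_ne z
  have hdet : (∏ k, fixSign ρ c k) * ((Equiv.Perm.sign ρ : ℤ) : ℝ) = 1 := by
    rw [prod_fixSign, sign_mul_self_cast]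
  exact (typeFrame_comp_of_fixed hdet
    (h ρ _ (fixSign_mul_self ρ c) hdet hρz (by simp [fixSign, hcz.symm])) t).symm

/-! ### The model forms -/

/-- The covector `dx_k` for `t = false` and `dy_k` for `t = true`. -/
def coord {n : ℕ} (t : Bool) (k : Fin n) : Phase n →L[ℝ] ℝ :=
  (EuclideanSpace.proj k).comp (proj t)

theorem coord_apply {n : ℕ} (t : Bool) (k : Fin n) (v : Phase n) : coord t k v = proj t v k := rfl

theorem coord_false {n : ℕ} (k : Fin n) : coord false k = dx k := rfl

theorem coord_true {n : ℕ} (k : Fin n) : coord true k = dy k := rfl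

/-- The matrix with the given vectors as rows. -/
def rowMatrix {n d : ℕ} (r : Fin d → EuclideanSpace ℝ (Fin n)) : Matrix (Fin d) (Fin n) ℝ :=
  Matrix.of fun j k => r j k

theorem det_rowMatrix {n : ℕ} (r : Fin n → EuclideanSpace ℝ (Fin n)) :
    (rowMatrix r).det = ∑ π : Equiv.Perm (Fin n), ((Equiv.Perm.sign π : ℤ) : ℝ) *
      ∏ j, r j (π j) := by
  rw [← Matrix.det_transpose, Matrix.det_apply']
  rfl

theorem det_rowMatrix_toEuclideanCLM {n : ℕ} {g : Matrix (Fin n) (Fin n) ℝ} (hg : g.det = 1)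
    (r : Fin n → EuclideanSpace ℝ (Fin n)) :
    (rowMatrix fun j => Matrix.toEuclideanCLM (n := Fin n) (𝕜 := ℝ) g (r j)).det =
      (rowMatrix r).det := by
  have h : (rowMatrix fun j => Matrix.toEuclideanCLM (n := Fin n) (𝕜 := ℝ) g (r j)) =
      rowMatrix r * g.transpose := by
    ext j k
    simp [rowMatrix, Matrix.mul_apply, Matrix.mulVec, dotProduct, mul_comm]
  rw [h, Matrix.det_mul, Matrix.det_transpose, hg, mul_one]

theorem det_rowMatrix_smul {n : ℕ} (c : Fin n → ℝ) (r : Fin n → EuclideanSpace ℝ (Fin n)) :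
    (rowMatrix fun j => c j • r j).det = (∏ j, c j) * (rowMatrix r).det :=
  Matrix.det_mul_column c (rowMatrix r)

theorem det_rowMatrix_single_perm {n : ℕ} (π : Equiv.Perm (Fin n)) :
    (rowMatrix fun j => EuclideanSpace.single (π j) (1 : ℝ)).det =
      ((Equiv.Perm.sign π : ℤ) : ℝ) := by
  have h : (rowMatrix fun j => EuclideanSpace.single (π j) (1 : ℝ)) = π.permMatrix ℝ := by
    ext j k
    simp [rowMatrix, Equiv.Perm.permMatrix, PEquiv.toMatrix_apply, eq_comm]
  rw [h, Matrix.det_permutation]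

theorem det_rowMatrix_single_of_not_injective {n : ℕ} {k : Fin n → Fin n}
    (hk : ¬ Function.Injective k) :
    (rowMatrix fun j => EuclideanSpace.single (k j) (1 : ℝ)).det = 0 := by
  simp only [Function.Injective, not_forall] at hk
  obtain ⟨a, b, hab, hne⟩ := hk
  refine Matrix.det_zero_of_row_eq hne ?_
  ext j
  simp [rowMatrix, hab]

/-- The form `∑ π, sign π • ξ_{π 0} ∧ ⋯ ∧ ξ_{π (n-1)}`, where the `j`-th factor is a `dx` or a
`dy` according to `s j`. -/
def alternant {n : ℕ} (s : Fin n → Bool) : Phase n [⋀^Fin n]→L[ℝ] ℝ :=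
  ∑ π : Equiv.Perm (Fin n), ((Equiv.Perm.sign π : ℤ) : ℝ) •
    covWedge (fun j => coord (s j) (π j))

/-- The form `∑ π, sign π • x_{π 0} ξ_{π 1} ∧ ⋯ ∧ ξ_{π m}`. -/
def radialAlternant {m : ℕ} (s : Fin m → Bool) (p : Phase (m + 1)) :
    Phase (m + 1) [⋀^Fin m]→L[ℝ] ℝ :=
  ∑ π : Equiv.Perm (Fin (m + 1)), (((Equiv.Perm.sign π : ℤ) : ℝ) * p.1 (π 0)) •
    covWedge (fun j => coord (s j) (π j.succ))

/-- The one-form `∑ k, x_k ξ_k`, which is `γ` for `s = false` and `β` for `s = true`. -/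
def radialForm {n : ℕ} (s : Bool) (p : Phase n) : Phase n [⋀^Fin 1]→L[ℝ] ℝ :=
  ∑ k : Fin n, p.1 k • oneForm (coord s k)

/-- The common shape of `γ ∧ τ_i` and `β ∧ τ_{i-1}`. -/
def radialWedge {m : ℕ} (s₀ : Bool) (s : Fin m → Bool) (p : Phase (m + 1)) :
    Phase (m + 1) [⋀^Fin (m + 1)]→L[ℝ] ℝ :=
  wedge (Nat.add_comm 1 m) (radialForm s₀ p) (radialAlternant s p)

theorem sum_apply {E ι : Type*} [NormedAddCommGroup E] [NormedSpace ℝ E] {d : ℕ} (s : Finset ι)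
    (f : ι → E [⋀^Fin d]→L[ℝ] ℝ) (v : Fin d → E) : (∑ a ∈ s, f a) v = ∑ a ∈ s, f a v := by
  induction s using Finset.cons_induction with
  | empty => simp
  | cons a s ha ih => simp [Finset.sum_cons, ih]

theorem alternant_apply {n : ℕ} (s : Fin n → Bool) (v : Fin n → Phase n) :
    alternant s v = ∑ σ : Equiv.Perm (Fin n), ((Equiv.Perm.sign σ : ℤ) : ℝ) *
      (rowMatrix fun j => proj (s j) (v (σ j))).det := by
  simp only [alternant, sum_apply, ContinuousAlternatingMap.smul_apply, covWedge_apply,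
    det_rowMatrix, coord_apply, smul_eq_mul, Finset.mul_sum]
  rw [Finset.sum_comm]
  exact Finset.sum_congr rfl fun _ _ => Finset.sum_congr rfl fun _ _ => by ring

theorem radialAlternant_apply {m : ℕ} (s : Fin m → Bool) (p : Phase (m + 1))
    (v : Fin m → Phase (m + 1)) :
    radialAlternant s p v = ∑ σ : Equiv.Perm (Fin m), ((Equiv.Perm.sign σ : ℤ) : ℝ) *
      (rowMatrix (Fin.cons p.1 fun j => proj (s j) (v (σ j)))).det := by
  simp only [radialAlternant, sum_apply, ContinuousAlternatingMap.smul_apply, covWedge_apply,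
    det_rowMatrix, coord_apply, smul_eq_mul, Finset.mul_sum, Fin.prod_univ_succ, Fin.cons_zero,
    Fin.cons_succ]
  rw [Finset.sum_comm]
  exact Finset.sum_congr rfl fun _ _ => Finset.sum_congr rfl fun _ _ => by ring

theorem radialForm_apply {n : ℕ} (s : Bool) (p : Phase n) (v : Fin 1 → Phase n) :
    radialForm s p v = inner ℝ p.1 (proj s (v 0)) := by
  simp only [radialForm, sum_apply, ContinuousAlternatingMap.smul_apply, oneForm_apply,
    coord_apply, smul_eq_mul]
  simp [PiLp.inner_apply, mul_comm]

/-- The normalizing factor in the definition of the exterior product of a one-form and an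
`m`-form is `1 / m!`. -/
theorem radialWedge_apply {m : ℕ} (s₀ : Bool) (s : Fin m → Bool) (p : Phase (m + 1))
    (v : Fin (m + 1) → Phase (m + 1)) :
    radialWedge s₀ s p v = (m ! : ℝ)⁻¹ * ∑ σ : Equiv.Perm (Fin (m + 1)),
      ∑ σ' : Equiv.Perm (Fin m), ((Equiv.Perm.sign σ : ℤ) : ℝ) * ((Equiv.Perm.sign σ' : ℤ) : ℝ) *
        inner ℝ p.1 (proj s₀ (v (σ 0))) *
        (rowMatrix (Fin.cons p.1 fun j => proj (s j) (v (σ (σ' j).succ)))).det := by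
  have h0 : Fin.cast (Nat.add_comm 1 m) (Fin.castAdd m (0 : Fin 1)) = 0 := rfl
  have h1 : ∀ j : Fin m, Fin.cast (Nat.add_comm 1 m) (Fin.natAdd 1 j) = j.succ := fun j =>
    Fin.ext (by simp)
  simp only [radialWedge, wedge_apply, tensor_apply, radialForm_apply, radialAlternant_apply,
    Function.comp_apply, h0, h1, Nat.factorial_one, Nat.cast_one, one_mul, Finset.mul_sum]
  exact Finset.sum_congr rfl fun _ _ => Finset.sum_congr rfl fun _ _ => by ring

theorem alternant_comp_diagAct {n : ℕ} (s : Fin n → Bool) {g : Matrix (Fin n) (Fin n) ℝ}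
    (hg : g ∈ Matrix.specialOrthogonalGroup (Fin n) ℝ) :
    (alternant s).compContinuousLinearMap (diagAct g) = alternant s := by
  ext v
  simp only [ContinuousAlternatingMap.compContinuousLinearMap_apply, alternant_apply,
    Function.comp_apply, proj_diagAct,
    det_rowMatrix_toEuclideanCLM (Matrix.mem_specialOrthogonalGroup_iff.1 hg).2]

theorem inner_toEuclideanCLM_of_mem {n : ℕ} {g : Matrix (Fin n) (Fin n) ℝ}
    (hg : g ∈ Matrix.orthogonalGroup (Fin n) ℝ) (x y : EuclideanSpace ℝ (Fin n)) :
    inner ℝ (Matrix.toEuclideanCLM (n := Fin n) (𝕜 := ℝ) g x)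
      (Matrix.toEuclideanCLM (n := Fin n) (𝕜 := ℝ) g y) = inner ℝ x y := by
  rw [Matrix.inner_toEuclideanCLM, Matrix.ofLp_toEuclideanCLM, Matrix.dotProduct_mulVec,
    Matrix.vecMul_mulVec, (Matrix.mem_orthogonalGroup_iff' _ _).1 hg]
  simp [PiLp.inner_apply, dotProduct, mul_comm]

theorem radialWedge_comp_diagAct {m : ℕ} (s₀ : Bool) (s : Fin m → Bool) (p : Phase (m + 1))
    {g : Matrix (Fin (m + 1)) (Fin (m + 1)) ℝ}
    (hg : g ∈ Matrix.specialOrthogonalGroup (Fin (m + 1)) ℝ) :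
    (radialWedge s₀ s (diagAct g p)).compContinuousLinearMap (diagAct g) =
      radialWedge s₀ s p := by
  have hg' := Matrix.mem_specialOrthogonalGroup_iff.1 hg
  have h0 : (diagAct g p).1 = Matrix.toEuclideanCLM (n := Fin (m + 1)) (𝕜 := ℝ) g p.1 :=
    proj_diagAct false g p
  have h1 : ∀ r : Fin m → EuclideanSpace ℝ (Fin (m + 1)),
      (Fin.cons (Matrix.toEuclideanCLM (n := Fin (m + 1)) (𝕜 := ℝ) g p.1)
        fun j => Matrix.toEuclideanCLM (n := Fin (m + 1)) (𝕜 := ℝ) g (r j) :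
          Fin (m + 1) → EuclideanSpace ℝ (Fin (m + 1))) =
      fun j => Matrix.toEuclideanCLM (n := Fin (m + 1)) (𝕜 := ℝ) g
        ((Fin.cons p.1 r : Fin (m + 1) → EuclideanSpace ℝ (Fin (m + 1))) j) := by
    intro r
    funext j
    refine Fin.cases ?_ (fun j => ?_) j <;> simp
  ext v
  simp only [ContinuousAlternatingMap.compContinuousLinearMap_apply, radialWedge_apply,
    Function.comp_apply, proj_diagAct, h0, h1, inner_toEuclideanCLM_of_mem hg'.1,
    det_rowMatrix_toEuclideanCLM hg'.2]

theorem alternant_basisVec {n : ℕ} (s : Fin n → Bool) (t : Fin n → Bool) (k : Fin n → Fin n) :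
    alternant s (fun j => basisVec (t j) (k j)) = ∑ σ : Equiv.Perm (Fin n),
      ((Equiv.Perm.sign σ : ℤ) : ℝ) * ((∏ j, if t (σ j) = s j then 1 else 0) *
        (rowMatrix fun j => EuclideanSpace.single (k (σ j)) (1 : ℝ)).det) := by
  simp only [alternant_apply, proj_basisVec, det_rowMatrix_smul]

theorem alternant_eq_zero {n : ℕ} (s : Fin n → Bool) (t : Fin n → Bool) {k : Fin n → Fin n}
    (hk : ¬ Function.Injective k) : alternant s (fun j => basisVec (t j) (k j)) = 0 := by
  rw [alternant_basisVec]
  refine Finset.sum_eq_zero fun σ _ => ?_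
  rw [det_rowMatrix_single_of_not_injective, mul_zero, mul_zero]
  exact fun h => hk fun a b hab => by
    simpa using h (a₁ := σ.symm a) (a₂ := σ.symm b) (by simpa using hab)

theorem alternant_typeFrame {n : ℕ} (s : Fin n → Bool) (t : Fin n → Bool) :
    alternant s (typeFrame t) = ∑ σ : Equiv.Perm (Fin n), if t ∘ σ = s then (1 : ℝ) else 0 := by
  rw [show typeFrame t = fun j => basisVec (t j) (id j) from rfl, alternant_basisVec]
  refine Finset.sum_congr rfl fun σ _ => ?_
  simp only [id, det_rowMatrix_single_perm]
  rw [mul_left_comm, sign_mul_self_cast, mul_one, Finset.prod_ite_zero]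
  simp [funext_iff]

theorem alternant_typeFrame_eq_zero {n : ℕ} {s t : Fin n → Bool}
    (h : typeCount t ≠ typeCount s) : alternant s (typeFrame t) = 0 := by
  rw [alternant_typeFrame]
  refine Finset.sum_eq_zero fun σ _ => if_neg ?_
  rintro rfl
  exact h (typeCount_comp t σ).symm

theorem alternant_typeFrame_pos {n : ℕ} {s t : Fin n → Bool}
    (h : typeCount t = typeCount s) : 0 < alternant s (typeFrame t) := by
  rw [alternant_typeFrame]
  obtain ⟨σ, hσ⟩ := exists_perm_comp_eq h
  refine Finset.sum_pos' (fun _ _ => by split_ifs <;> simp) ⟨σ, Finset.mem_univ _, by simp [hσ]⟩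

/-- The extension of a permutation of the positions `1, …, m` by `0 ↦ 0`. -/
abbrev extendPerm {m : ℕ} (σ' : Equiv.Perm (Fin m)) : Equiv.Perm (Fin (m + 1)) :=
  Equiv.Perm.decomposeFin.symm (0, σ')

theorem extendPerm_succ {m : ℕ} (σ' : Equiv.Perm (Fin m)) (j : Fin m) :
    extendPerm σ' j.succ = (σ' j).succ := by
  simp [extendPerm]

theorem extendPerm_zero {m : ℕ} (σ' : Equiv.Perm (Fin m)) : extendPerm σ' 0 = 0 := by
  simp [extendPerm]

theorem sign_extendPerm {m : ℕ} (σ' : Equiv.Perm (Fin m)) :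
    Equiv.Perm.sign (extendPerm σ') = Equiv.Perm.sign σ' := by
  simp [extendPerm]

/-- At a point of the first coordinate axis the row `x` of the determinants in `radialWedge_apply`
has the same direction as the vector that the one-form is applied to, so that the two
alternations combine to one. -/
theorem radialWedge_basisVec {m : ℕ} (s₀ : Bool) (s : Fin m → Bool) {p : Phase (m + 1)} {r : ℝ}
    (hp : p.1 = r • EuclideanSpace.single 0 1) (t : Fin (m + 1) → Bool)
    (k : Fin (m + 1) → Fin (m + 1)) :
    radialWedge s₀ s p (fun j => basisVec (t j) (k j)) =
      r ^ 2 * ((m ! : ℝ)⁻¹ * ∑ σ : Equiv.Perm (Fin (m + 1)), ∑ σ' : Equiv.Perm (Fin m),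
        ((Equiv.Perm.sign (σ * extendPerm σ') : ℤ) : ℝ) *
        ((if k (σ 0) = 0 then 1 else 0) *
        ((∏ j, if t ((σ * extendPerm σ') j) = (Fin.cons s₀ s : Fin (m + 1) → Bool) j
          then 1 else 0) *
        (rowMatrix fun j => EuclideanSpace.single (k ((σ * extendPerm σ') j)) (1 : ℝ)).det))) := by
  rw [radialWedge_apply, mul_left_comm]
  congr 1
  rw [Finset.mul_sum]
  refine Finset.sum_congr rfl fun σ _ => ?_
  rw [Finset.mul_sum]
  refine Finset.sum_congr rfl fun σ' _ => ?_
  rw [Equiv.Perm.sign_mul, sign_extendPerm, proj_basisVec, hp, inner_smul_left, inner_smul_right,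
    Units.val_mul, Int.cast_mul]
  by_cases h0 : k (σ 0) = 0
  · have h1 : (Fin.cons (r • EuclideanSpace.single 0 1) fun j =>
          proj (s j) (basisVec (t (σ (σ' j).succ)) (k (σ (σ' j).succ))) :
          Fin (m + 1) → EuclideanSpace ℝ (Fin (m + 1))) =
        fun j => (Fin.cons r (fun j => if t (σ (σ' j).succ) = s j then 1 else 0) :
          Fin (m + 1) → ℝ) j •
          EuclideanSpace.single (k ((σ * extendPerm σ') j)) (1 : ℝ) := by
      funext j
      refine Fin.cases ?_ (fun j => ?_) j
      · simp only [Fin.cons_zero, Equiv.Perm.mul_apply, extendPerm_zero, h0]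
      · simp only [Fin.cons_succ, Equiv.Perm.mul_apply, extendPerm_succ, proj_basisVec]
    rw [h1, det_rowMatrix_smul, Fin.prod_univ_succ, Fin.prod_univ_succ]
    have hz : (σ * extendPerm σ') 0 = σ 0 := by rw [Equiv.Perm.mul_apply, extendPerm_zero]
    have hs : ∀ j : Fin m, (σ * extendPerm σ') j.succ = σ (σ' j).succ := fun j => by
      rw [Equiv.Perm.mul_apply, extendPerm_succ]
    simp only [Fin.cons_zero, Fin.cons_succ, hz, hs, h0, conj_trivial,
      inner_self_eq_norm_sq_to_K, PiLp.norm_single, norm_one]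
    split_ifs <;> simp
    ring
  · have : inner ℝ (EuclideanSpace.single (0 : Fin (m + 1)) (1 : ℝ))
        (EuclideanSpace.single (k (σ 0)) (1 : ℝ)) = 0 := by
      rw [EuclideanSpace.inner_single_left]
      simp [Ne.symm h0]
    rw [this]
    simp [h0]

theorem radialWedge_eq_zero {m : ℕ} (s₀ : Bool) (s : Fin m → Bool) {p : Phase (m + 1)} {r : ℝ}
    (hp : p.1 = r • EuclideanSpace.single 0 1) (t : Fin (m + 1) → Bool)
    {k : Fin (m + 1) → Fin (m + 1)} (hk : ¬ Function.Injective k) :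
    radialWedge s₀ s p (fun j => basisVec (t j) (k j)) = 0 := by
  rw [radialWedge_basisVec s₀ s hp]
  refine mul_eq_zero_of_right _ (mul_eq_zero_of_right _ (Finset.sum_eq_zero fun σ _ =>
    Finset.sum_eq_zero fun σ' _ => ?_))
  rw [det_rowMatrix_single_of_not_injective, mul_zero, mul_zero, mul_zero]
  intro h
  refine hk fun a b hab => ?_
  have := h (a₁ := (σ * extendPerm σ').symm a) (a₂ := (σ * extendPerm σ').symm b)
    (by simpa only [Equiv.apply_symm_apply] using hab)
  simpa only [EmbeddingLike.apply_eq_iff_eq] using this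

theorem radialWedge_typeFrame {m : ℕ} (s₀ : Bool) (s : Fin m → Bool) {p : Phase (m + 1)} {r : ℝ}
    (hp : p.1 = r • EuclideanSpace.single 0 1) (t : Fin (m + 1) → Bool) :
    radialWedge s₀ s p (typeFrame t) =
      r ^ 2 * ((m ! : ℝ)⁻¹ * ∑ σ : Equiv.Perm (Fin (m + 1)), ∑ σ' : Equiv.Perm (Fin m),
        if σ 0 = 0 ∧ t ∘ (σ * extendPerm σ') = Fin.cons s₀ s then (1 : ℝ) else 0) := by
  rw [show typeFrame t = fun j => basisVec (t j) (id j) from rfl, radialWedge_basisVec s₀ s hp]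
  congr 2
  refine Finset.sum_congr rfl fun σ _ => Finset.sum_congr rfl fun σ' _ => ?_
  simp only [id, det_rowMatrix_single_perm]
  rw [mul_left_comm, mul_left_comm _ (∏ j, _), sign_mul_self_cast, mul_one,
    Finset.prod_ite_zero]
  by_cases h0 : σ 0 = 0 <;> simp [h0, funext_iff]

theorem radialWedge_typeFrame_eq_zero {m : ℕ} {s₀ : Bool} {s : Fin m → Bool}
    {p : Phase (m + 1)} {r : ℝ} (hp : p.1 = r • EuclideanSpace.single 0 1)
    {t : Fin (m + 1) → Bool}
    (h : ¬ (t 0 = s₀ ∧ typeCount t = typeCount (Fin.cons s₀ s : Fin (m + 1) → Bool))) :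
    radialWedge s₀ s p (typeFrame t) = 0 := by
  rw [radialWedge_typeFrame s₀ s hp]
  refine mul_eq_zero_of_right _ (mul_eq_zero_of_right _ (Finset.sum_eq_zero fun σ _ =>
    Finset.sum_eq_zero fun σ' _ => if_neg ?_))
  rintro ⟨h0, h1⟩
  refine h ⟨?_, by rw [← h1, typeCount_comp]⟩
  have := congrFun h1 0
  simpa only [Function.comp_apply, Equiv.Perm.mul_apply, extendPerm_zero, h0, Fin.cons_zero]
    using this

/-- The value `radialWedge s₀ s e_0 (typeFrame t)` is positive; at a multiple `r e_0` of `e_0` it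
is multiplied by `r ^ 2`. -/
theorem exists_radialWedge_typeFrame_pos {m : ℕ} {s₀ : Bool} {s : Fin m → Bool}
    {t : Fin (m + 1) → Bool} (h0 : t 0 = s₀)
    (hc : typeCount t = typeCount (Fin.cons s₀ s : Fin (m + 1) → Bool)) :
    ∃ A : ℝ, 0 < A ∧ ∀ (p : Phase (m + 1)) (r : ℝ), p.1 = r • EuclideanSpace.single 0 1 →
      radialWedge s₀ s p (typeFrame t) = r ^ 2 * A := by
  refine ⟨_, ?_, fun p r hp => radialWedge_typeFrame s₀ s hp t⟩
  have hnn : ∀ (σ : Equiv.Perm (Fin (m + 1))) (σ' : Equiv.Perm (Fin m)),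
      (0 : ℝ) ≤ if σ 0 = 0 ∧ t ∘ (σ * extendPerm σ') = Fin.cons s₀ s then (1 : ℝ) else 0 :=
    fun σ σ' => by split_ifs <;> simp
  obtain ⟨σ, hσ, hσ0⟩ := exists_perm_comp_eq_of_apply_eq hc (z := 0) (by simpa using h0)
  refine mul_pos (by positivity) (Finset.sum_pos' (fun σ _ => Finset.sum_nonneg fun σ' _ =>
    hnn σ σ') ⟨σ, Finset.mem_univ _, Finset.sum_pos' (fun σ' _ => hnn σ σ')
      ⟨1, Finset.mem_univ _, ?_⟩⟩)
  have h1 : (extendPerm (1 : Equiv.Perm (Fin m))) = 1 := by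
    ext j : 1
    refine Fin.cases ?_ (fun j => ?_) j
    · rw [extendPerm_zero]; rfl
    · rw [extendPerm_succ]; rfl
  rw [if_pos ⟨hσ0, by rw [h1, mul_one, hσ]⟩]
  exact one_pos

/-! ### Primitive invariant forms -/

theorem sympForm_apply {n : ℕ} (v : Fin 2 → Phase n) :
    sympForm n v = inner ℝ (v 0).1 (v 1).2 - inner ℝ (v 1).1 (v 0).2 := by
  simp only [sympForm, sum_apply, covWedge_apply, Fin.prod_univ_two]
  have h : ∀ f : Equiv.Perm (Fin 2) → ℝ, ∑ σ, f σ = f 1 + f (Equiv.swap 0 1) := by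
    intro f
    rw [show (Finset.univ : Finset (Equiv.Perm (Fin 2))) = {1, Equiv.swap 0 1} by decide,
      Finset.sum_pair (by decide)]
  simp only [h]
  simp [dx, dy, PiLp.inner_apply, Finset.sum_add_distrib, mul_comm]
  ring

theorem sympForm_basisVec {n : ℕ} (t : Fin 2 → Bool) (k : Fin 2 → Fin n) :
    sympForm n (fun j => basisVec (t j) (k j)) =
      if k 0 = k 1 then (if t 1 then 1 else 0) - (if t 0 then 1 else 0) else 0 := by
  rw [sympForm_apply]
  by_cases hk : k 0 = k 1
  · cases h0 : t 0 <;> cases h1 : t 1 <;>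
      simp [basisVec, hk]
  · cases h0 : t 0 <;> cases h1 : t 1 <;>
      simp [basisVec, hk, Ne.symm hk, EuclideanSpace.inner_single_left]

theorem sympForm_comp_diagAct {n : ℕ} {g : Matrix (Fin n) (Fin n) ℝ}
    (hg : g ∈ Matrix.specialOrthogonalGroup (Fin n) ℝ) :
    (sympForm n).compContinuousLinearMap (diagAct g) = sympForm n := by
  have hg' := (Matrix.mem_specialOrthogonalGroup_iff.1 hg).1
  ext v
  simp only [ContinuousAlternatingMap.compContinuousLinearMap_apply, Function.comp_apply,
    sympForm_apply]
  exact congrArg₂ (· - ·) (inner_toEuclideanCLM_of_mem hg' _ _)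
    (inner_toEuclideanCLM_of_mem hg' _ _)

/-- A permutation that preserves the second block of positions contributes to the exterior product
in the same way as the identity. -/
theorem sign_mul_tensor_comp_of_mapsTo {E : Type*} [NormedAddCommGroup E] [NormedSpace ℝ E]
    {a b : ℕ} (α : E [⋀^Fin a]→L[ℝ] ℝ) (β : E [⋀^Fin b]→L[ℝ] ℝ) (v : Fin (a + b) → E)
    {σ : Equiv.Perm (Fin (a + b))}
    (hσ : ∀ j : Fin b, ∃ j', σ (Fin.natAdd a j) = Fin.natAdd a j') :
    ((Equiv.Perm.sign σ : ℤ) : ℝ) * tensor rfl α β (v ∘ σ) = tensor rfl α β v := by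
  let e : Equiv.Perm (Fin a ⊕ Fin b) := finSumFinEquiv.symm.permCongr σ
  have hinr : Set.MapsTo e (Set.range Sum.inr) (Set.range Sum.inr) := by
    rintro _ ⟨j, rfl⟩
    obtain ⟨j', hj'⟩ := hσ j
    exact ⟨j', by simp [e, Equiv.permCongr_apply, hj']⟩
  obtain ⟨⟨τ₁, τ₂⟩, hτ⟩ := Equiv.Perm.mem_sumCongrHom_range_of_perm_mapsTo_inl
    ((Equiv.Perm.perm_mapsTo_inl_iff_mapsTo_inr e).2 hinr)
  have hl : ∀ j, σ (Fin.castAdd b j) = Fin.castAdd b (τ₁ j) := by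
    intro j
    have := congrArg finSumFinEquiv (DFunLike.congr_fun hτ (Sum.inl j))
    simpa [e, Equiv.permCongr_apply] using this.symm
  have hr : ∀ j, σ (Fin.natAdd a j) = Fin.natAdd a (τ₂ j) := by
    intro j
    have := congrArg finSumFinEquiv (DFunLike.congr_fun hτ (Sum.inr j))
    simpa [e, Equiv.permCongr_apply] using this.symm
  have hs : Equiv.Perm.sign σ = Equiv.Perm.sign τ₁ * Equiv.Perm.sign τ₂ := by
    rw [← Equiv.Perm.sign_sumCongr, ← Equiv.Perm.sign_permCongr finSumFinEquiv.symm σ]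
    exact congrArg _ hτ.symm
  have h1 := α.toAlternatingMap.map_perm (fun j => v (Fin.castAdd b j)) τ₁
  have h2 := β.toAlternatingMap.map_perm (fun j => v (Fin.natAdd a j)) τ₂
  simp only [ContinuousAlternatingMap.coe_toAlternatingMap, Units.smul_def, zsmul_eq_mul,
    Function.comp_def] at h1 h2
  simp only [tensor_apply, Function.comp_apply, Fin.cast_eq_self, hl, hr, h1, h2, hs,
    Units.val_mul, Int.cast_mul]
  linear_combination (α (fun j => v (Fin.castAdd b j)) * β (fun j => v (Fin.natAdd a j)) *
    (((Equiv.Perm.sign τ₂ : ℤ) : ℝ) * ((Equiv.Perm.sign τ₂ : ℤ) : ℝ))) * sign_mul_self_cast τ₁ +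
    α (fun j => v (Fin.castAdd b j)) * β (fun j => v (Fin.natAdd a j)) * sign_mul_self_cast τ₂

/-- The signs `-1` at `a` and `1` elsewhere. -/
def flipSign {n : ℕ} (a : Fin n) : Fin n → ℝ := fun k => if k = a then -1 else 1

theorem flipSign_mul_self {n : ℕ} (a k : Fin n) : flipSign a k * flipSign a k = 1 := by
  unfold flipSign
  split_ifs <;> simp

theorem prod_flipSign {n d : ℕ} (a : Fin n) (k : Fin d → Fin n) :
    ∏ j, flipSign a (k j) = (-1) ^ Fintype.card {j // k j = a} := by
  simp [flipSign, Finset.prod_ite, Fintype.card_subtype]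

/-- Evaluate `α ∧ ω_s = 0` on the given frame extended by `∂/∂x_c, ∂/∂y_c`. The contraction with
any conjugate pair of the extended frame other than one in the direction `e_z` gives the same
value, because a signed permutation in `SO(n)` moves the pair to the last two positions; with a
pair in the direction `e_z` it is zero by `hz`. Hence the value on the frame, times a positive
integer, is zero. -/
theorem apply_eq_zero_of_primitive_of_missing {n : ℕ} {z : Fin n} {α : Phase n [⋀^Fin n]→L[ℝ] ℝ}
    (hfix : IsFixedBySigned z α) (hprim : wedge rfl α (sympForm n) = 0)
    {t : Fin n → Bool} {k : Fin n → Fin n} {c : Fin n} (hcz : c ≠ z) (hc : ∀ j, k j ≠ c)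
    (hz : (∀ j, k j ≠ z) ∨ ∀ (t : Fin n → Bool) (k : Fin n → Fin n), (∀ j, k j ≠ z) →
      α (fun j => basisVec (t j) (k j)) = 0) :
    α (fun j => basisVec (t j) (k j)) = 0 := by
  by_contra hne
  let t' : Fin (n + 2) → Bool := Fin.append t ![false, true]
  let k' : Fin (n + 2) → Fin n := Fin.append k ![c, c]
  let v : Fin (n + 2) → Phase n := fun j => basisVec (t' j) (k' j)
  let l₀ : Fin (n + 2) := Fin.natAdd n 0
  let l₁ : Fin (n + 2) := Fin.natAdd n 1
  have ht0 : t' l₀ = false := by simp only [t', l₀, Fin.append_right]; rfl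
  have ht1 : t' l₁ = true := by simp only [t', l₁, Fin.append_right]; rfl
  have hk0 : k' l₀ = c := by simp only [k', l₀, Fin.append_right]; rfl
  have hk1 : k' l₁ = c := by simp only [k', l₁, Fin.append_right]; rfl
  have hlast : ∀ j : Fin (n + 2), (∃ j' : Fin n, j = Fin.castAdd 2 j') ∨ j = l₀ ∨ j = l₁ := by
    intro j
    refine Fin.addCases (fun j' => Or.inl ⟨j', rfl⟩) (fun j' => Or.inr ?_) j
    fin_cases j'
    · exact Or.inl rfl
    · exact Or.inr rfl
  have hkl : ∀ j' : Fin n, k' (Fin.castAdd 2 j') = k j' := fun j' => Fin.append_left _ _ _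
  have htl : ∀ j' : Fin n, t' (Fin.castAdd 2 j') = t j' := fun j' => Fin.append_left _ _ _
  have hinj : ∀ i j, t' i = t' j → k' i = k' j → i = j := by
    intro i j hti hki
    rcases hlast i with ⟨i', rfl⟩ | rfl | rfl <;> rcases hlast j with ⟨j', rfl⟩ | rfl | rfl
    · by_contra h
      refine hne (map_eq_zero_of_eq_basisVec α (a := i') (b := j') ?_ ?_ fun h' => h (by rw [h']))
      · simpa only [htl] using hti
      · simpa only [hkl] using hki
    · rw [hkl, hk0] at hki; exact absurd hki (hc _)
    · rw [hkl, hk1] at hki; exact absurd hki (hc _)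
    · rw [hkl, hk0] at hki; exact absurd hki.symm (hc _)
    · rfl
    · rw [ht0, ht1] at hti; cases hti
    · rw [hkl, hk1] at hki; exact absurd hki.symm (hc _)
    · rw [ht0, ht1] at hti; cases hti
    · rfl
  -- the summands of the alternation that defines `α ∧ ω_s`; each is zero or equal to `T 1`
  let T : Equiv.Perm (Fin (n + 2)) → ℝ := fun σ =>
    ((Equiv.Perm.sign σ : ℤ) : ℝ) * tensor rfl α (sympForm n) (v ∘ σ)
  have hTeq : ∀ σ, T σ = ((Equiv.Perm.sign σ : ℤ) : ℝ) *
      (α (fun j => basisVec (t' (σ (Fin.castAdd 2 j))) (k' (σ (Fin.castAdd 2 j)))) *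
        sympForm n (fun j => basisVec (t' (σ (Fin.natAdd n j))) (k' (σ (Fin.natAdd n j))))) :=
    fun σ => rfl
  have hsum : ∑ σ, T σ = 0 := by
    have h := wedge_apply rfl α (sympForm n) v
    rw [hprim] at h
    have h' := (mul_eq_zero.1 h.symm).resolve_left (by positivity)
    exact h'
  have hT1 : T 1 = α (fun j => basisVec (t j) (k j)) := by
    rw [hTeq, sympForm_basisVec]
    simp only [Equiv.Perm.coe_one, id, htl, hkl, Equiv.Perm.sign_one, Units.val_one, Int.cast_one,
      one_mul]
    change _ * (if k' l₀ = k' l₁ then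
      (if t' l₁ = true then (1 : ℝ) else 0) - (if t' l₀ = true then 1 else 0) else 0) = _
    simp [hk0, hk1, ht0, ht1]
  have hblock : ∀ σ : Equiv.Perm (Fin (n + 2)),
      (σ l₀ = l₀ ∧ σ l₁ = l₁) ∨ (σ l₀ = l₁ ∧ σ l₁ = l₀) → T σ = T 1 := by
    intro σ hσ
    have h : ∀ j : Fin 2, ∃ j', σ (Fin.natAdd n j) = Fin.natAdd n j' := by
      intro j
      fin_cases j
      · rcases hσ with h | h
        · exact ⟨0, h.1⟩
        · exact ⟨1, h.1⟩
      · rcases hσ with h | h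
        · exact ⟨1, h.2⟩
        · exact ⟨0, h.2⟩
    have := sign_mul_tensor_comp_of_mapsTo α (sympForm n) v h
    simpa [T] using this
  have hT : ∀ σ, T σ = 0 ∨ T σ = T 1 := by
    intro σ
    by_cases hω : k' (σ l₀) = k' (σ l₁) ∧ t' (σ l₀) ≠ t' (σ l₁)
    swap
    · left
      rw [hTeq, sympForm_basisVec]
      change _ * (_ * (if k' (σ l₀) = k' (σ l₁) then
        (if t' (σ l₁) = true then (1 : ℝ) else 0) - (if t' (σ l₀) = true then 1 else 0)
          else 0)) = 0
      by_cases h1 : k' (σ l₀) = k' (σ l₁)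
      · have h2 : t' (σ l₀) = t' (σ l₁) := by
          by_contra h
          exact hω ⟨h1, h⟩
        simp [h1, h2]
      · simp [h1]
    obtain ⟨hk, ht⟩ := hω
    -- no position of the first block carries the index of the last two
    have hfirst : ∀ j : Fin n, k' (σ (Fin.castAdd 2 j)) ≠ k' (σ l₀) := by
      intro j hj
      have h3 : ∀ l : Fin 2, Fin.castAdd 2 j ≠ Fin.natAdd n l := fun l h => by
        have := congrArg Fin.val h
        simp at this
        omega
      by_cases h4 : t' (σ (Fin.castAdd 2 j)) = t' (σ l₀)
      · exact h3 0 (σ.injective (hinj _ _ h4 hj))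
      · have h5 : t' (σ (Fin.castAdd 2 j)) = t' (σ l₁) := by
          revert h4 ht
          cases t' (σ (Fin.castAdd 2 j)) <;> cases t' (σ l₀) <;> cases t' (σ l₁) <;> simp
        exact h3 1 (σ.injective (hinj _ _ h5 (hj.trans hk)))
    by_cases haz : k' (σ l₀) = z
    · left
      rcases hz with hz | hz
      · exfalso
        rcases hlast (σ l₀) with ⟨j', hj⟩ | hj | hj
        · rw [hj, hkl] at haz; exact hz _ haz
        · rw [hj, hk0] at haz; exact hcz haz
        · rw [hj, hk1] at haz; exact hcz haz
      · rw [hTeq, hz _ _ fun j => haz ▸ hfirst j, zero_mul, mul_zero]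
    right
    by_cases hac : k' (σ l₀) = c
    · have h6 : ∀ j, k' j = c → j = l₀ ∨ j = l₁ := by
        intro j hj
        cases h7 : t' j
        · exact Or.inl (hinj _ _ (h7.trans ht0.symm) (hj.trans hk0.symm))
        · exact Or.inr (hinj _ _ (h7.trans ht1.symm) (hj.trans hk1.symm))
      have hne01 : σ l₀ ≠ σ l₁ := fun h => ht (by rw [h])
      refine hblock σ ?_
      rcases h6 _ hac with h8 | h8 <;> rcases h6 _ (hk ▸ hac) with h9 | h9
      · exact absurd (h8.trans h9.symm) hne01
      · exact Or.inl ⟨h8, h9⟩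
      · exact Or.inr ⟨h8, h9⟩
      · exact absurd (h8.trans h9.symm) hne01
    -- `P` and `Q` are the positions of `∂/∂x_a` and `∂/∂y_a`
    obtain ⟨P, Q, hP, hQ, htP, htQ, hPQ⟩ : ∃ P Q, k' P = k' (σ l₀) ∧ k' Q = k' (σ l₀) ∧
        t' P = false ∧ t' Q = true ∧ ((σ l₀ = P ∧ σ l₁ = Q) ∨ (σ l₀ = Q ∧ σ l₁ = P)) := by
      cases h : t' (σ l₀)
      · exact ⟨σ l₀, σ l₁, rfl, hk.symm, h, by
          revert ht; rw [h]; cases t' (σ l₁) <;> simp, Or.inl ⟨rfl, rfl⟩⟩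
      · exact ⟨σ l₁, σ l₀, hk.symm, rfl, by
          revert ht; rw [h]; cases t' (σ l₁) <;> simp, h, Or.inr ⟨rfl, rfl⟩⟩
    set a := k' (σ l₀) with ha
    have hl01 : l₀ ≠ l₁ := fun h => by rw [h, ht1] at ht0; cases ht0
    have hPQne : P ≠ Q := fun h => by rw [h, htQ] at htP; cases htP
    have hP0 : P ≠ l₀ := fun h => hac (by rw [← hP, h, hk0])
    have hP1 : P ≠ l₁ := fun h => hac (by rw [← hP, h, hk1])
    have hQ0 : Q ≠ l₀ := fun h => hac (by rw [← hQ, h, hk0])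
    have hQ1 : Q ≠ l₁ := fun h => hac (by rw [← hQ, h, hk1])
    let π : Equiv.Perm (Fin (n + 2)) := Equiv.swap P l₀ * Equiv.swap Q l₁
    have hπP : π P = l₀ := by
      simp only [π, Equiv.Perm.mul_apply]
      rw [Equiv.swap_apply_of_ne_of_ne hPQne hP1, Equiv.swap_apply_left]
    have hπQ : π Q = l₁ := by
      simp only [π, Equiv.Perm.mul_apply]
      rw [Equiv.swap_apply_left, Equiv.swap_apply_of_ne_of_ne hP1.symm hl01.symm]
    have hπ0 : π l₀ = P := by
      simp only [π, Equiv.Perm.mul_apply]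
      rw [Equiv.swap_apply_of_ne_of_ne hQ0.symm hl01, Equiv.swap_apply_right]
    have hπ1 : π l₁ = Q := by
      simp only [π, Equiv.Perm.mul_apply]
      rw [Equiv.swap_apply_right, Equiv.swap_apply_of_ne_of_ne hPQne.symm hQ0]
    have hsignπ : Equiv.Perm.sign π = 1 := by
      simp [π, Equiv.Perm.sign_swap hP0, Equiv.Perm.sign_swap hQ1]
    have hπtk : ∀ j, t' (π j) = t' j ∧ k' (π j) = Equiv.swap a c (k' j) := by
      intro j
      by_cases h1 : j = P
      · subst h1; rw [hπP, ht0, htP, hP, hk0, Equiv.swap_apply_left]; exact ⟨rfl, rfl⟩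
      by_cases h2 : j = Q
      · subst h2; rw [hπQ, ht1, htQ, hQ, hk1, Equiv.swap_apply_left]; exact ⟨rfl, rfl⟩
      by_cases h3 : j = l₀
      · subst h3; rw [hπ0, ht0, htP, hP, hk0, Equiv.swap_apply_right]; exact ⟨rfl, rfl⟩
      by_cases h4 : j = l₁
      · subst h4; rw [hπ1, ht1, htQ, hQ, hk1, Equiv.swap_apply_right]; exact ⟨rfl, rfl⟩
      have hπj : π j = j := by
        simp only [π, Equiv.Perm.mul_apply]
        rw [Equiv.swap_apply_of_ne_of_ne h2 h4, Equiv.swap_apply_of_ne_of_ne h1 h3]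
      have hja : k' j ≠ a := fun h => by
        cases h7 : t' j
        · exact h1 (hinj _ _ (h7.trans htP.symm) (h.trans hP.symm))
        · exact h2 (hinj _ _ (h7.trans htQ.symm) (h.trans hQ.symm))
      have hjc : k' j ≠ c := fun h => by
        cases h7 : t' j
        · exact h3 (hinj _ _ (h7.trans ht0.symm) (h.trans hk0.symm))
        · exact h4 (hinj _ _ (h7.trans ht1.symm) (h.trans hk1.symm))
      rw [hπj, Equiv.swap_apply_of_ne_of_ne hja hjc]
      exact ⟨rfl, rfl⟩
    -- the rotation `e_a ↦ -e_c`, `e_c ↦ e_a` induces the permutation `π` of positions up to two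
    -- signs, which both fall on the conjugate pair
    have hdet : (∏ k, flipSign a k) * ((Equiv.Perm.sign (Equiv.swap a c) : ℤ) : ℝ) = 1 := by
      rw [Equiv.Perm.sign_swap hac]
      simp [flipSign]
    have hα := apply_signedPerm (hfix (Equiv.swap a c) _ (flipSign_mul_self a) hdet
      (Equiv.swap_apply_of_ne_of_ne (Ne.symm haz) (Ne.symm hcz)) (by simp [flipSign, Ne.symm haz]))
      (fun j => t' (σ (Fin.castAdd 2 j))) (fun j => k' (σ (Fin.castAdd 2 j)))
    have hω := apply_signedPerm (sympForm_comp_diagAct (signedPerm_mem (flipSign_mul_self a) hdet))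
      (fun j => t' (σ (Fin.natAdd n j))) (fun j => k' (σ (Fin.natAdd n j)))
    have hα1 : ∏ j : Fin n, flipSign a (k' (σ (Fin.castAdd 2 j))) = 1 :=
      Finset.prod_eq_one fun j _ => if_neg (hfirst j)
    have hω1 : ∏ j : Fin 2, flipSign a (k' (σ (Fin.natAdd n j))) = 1 := by
      rw [Fin.prod_univ_two]
      change flipSign a (k' (σ l₀)) * flipSign a (k' (σ l₁)) = 1
      rw [← hk]
      exact flipSign_mul_self _ _
    rw [hα1, one_mul] at hα
    rw [hω1, one_mul] at hω
    have hTπ : T (π * σ) = T σ := by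
      rw [hTeq, hTeq, hα, hω, Equiv.Perm.sign_mul, hsignπ, one_mul]
      simp only [Equiv.Perm.mul_apply, (hπtk _).1, (hπtk _).2]
    rw [← hTπ]
    refine hblock _ ?_
    simp only [Equiv.Perm.mul_apply]
    rcases hPQ with ⟨h1, h2⟩ | ⟨h1, h2⟩
    · exact Or.inl ⟨by rw [h1, hπP], by rw [h2, hπQ]⟩
    · exact Or.inr ⟨by rw [h1, hπQ], by rw [h2, hπP]⟩
  have hpos : 0 < ∑ σ, T σ * T 1 := by
    refine Finset.sum_pos' (fun σ _ => ?_) ⟨1, Finset.mem_univ _, ?_⟩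
    · rcases hT σ with h | h <;> rw [h]
      · simp
      · exact mul_self_nonneg _
    · rw [hT1]
      exact mul_self_pos.2 hne
  rw [← Finset.sum_mul, hsum, zero_mul] at hpos
  exact lt_irrefl _ hpos

/-- If the indices omit only the direction `z`, then one index occurs twice and, for `n ≥ 3`,
another one occurs once; flipping the signs of these two directions changes the sign of the
value. For `n = 2` the frame is a conjugate pair, so that `i = 1`. -/
theorem apply_eq_zero_of_forall_ne {n i : ℕ} (hn : 2 ≤ n) (hni : ¬ (n = 2 ∧ i = 1)) {z : Fin n}
    {α : Phase n [⋀^Fin n]→L[ℝ] ℝ} (hfix : IsFixedBySigned z α)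
    (hprim : wedge rfl α (sympForm n) = 0) (hbi : HasBidegree α i) (t : Fin n → Bool)
    (k : Fin n → Fin n) (hk : ∀ j, k j ≠ z) : α (fun j => basisVec (t j) (k j)) = 0 := by
  by_cases hc : ∃ c, c ≠ z ∧ ∀ j, k j ≠ c
  · obtain ⟨c, hcz, hc⟩ := hc
    exact apply_eq_zero_of_primitive_of_missing hfix hprim hcz hc (Or.inl hk)
  push Not at hc
  by_contra hne
  have hnotinj : ¬ Function.Injective k := fun h => by
    obtain ⟨j, hj⟩ := (Finite.injective_iff_surjective.1 h) z
    exact hk j hj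
  simp only [Function.Injective, not_forall] at hnotinj
  obtain ⟨j₁, j₂, hj, hj12⟩ := hnotinj
  have htne : t j₁ ≠ t j₂ := fun h => hne (map_eq_zero_of_eq_basisVec α h hj hj12)
  set a := k j₁ with ha
  have hNa : Fintype.card {j // k j = a} = 2 := by
    rw [Fintype.card_subtype, Finset.card_eq_two]
    refine ⟨j₁, j₂, hj12, ?_⟩
    ext j
    simp only [Finset.mem_filter, Finset.mem_univ, true_and, Finset.mem_insert,
      Finset.mem_singleton]
    constructor
    · intro h
      by_contra h'
      push Not at h'
      by_cases h1 : t j = t j₁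
      · exact hne (map_eq_zero_of_eq_basisVec α h1 h h'.1)
      · refine hne (map_eq_zero_of_eq_basisVec α (a := j) (b := j₂) ?_ (h.trans hj) h'.2)
        revert h1 htne
        cases t j <;> cases t j₁ <;> cases t j₂ <;> simp
    · rintro (rfl | rfl)
      · rfl
      · exact hj.symm
  rcases Nat.lt_or_ge 2 n with hn3 | hn2
  · have hb : ∃ b, b ≠ z ∧ Fintype.card {j // k j = b} < 2 := by
      by_contra hb
      push Not at hb
      have h1 : n = ∑ b, Fintype.card {j // k j = b} := by
        simp only [Fintype.card_subtype]
        rw [← Finset.card_eq_sum_card_fiberwise (fun _ _ => Finset.mem_univ _)]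
        simp
      have h2 : ∑ b ∈ Finset.univ.erase z, 2 ≤ ∑ b, Fintype.card {j // k j = b} :=
        (Finset.sum_le_sum fun b hb' => hb b (Finset.ne_of_mem_erase hb')).trans
          (Finset.sum_le_sum_of_subset (Finset.erase_subset _ _))
      rw [← h1, Finset.sum_const, Finset.card_erase_of_mem (Finset.mem_univ _), Finset.card_univ,
        Fintype.card_fin, smul_eq_mul] at h2
      omega
    obtain ⟨b, hbz, hNb⟩ := hb
    have hNb1 : Fintype.card {j // k j = b} = 1 := by
      obtain ⟨j, hj⟩ := hc b hbz
      have : 0 < Fintype.card {j // k j = b} := Fintype.card_pos_iff.2 ⟨⟨j, hj⟩⟩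
      omega
    have hab : a ≠ b := fun h => by rw [h, hNb1] at hNa; omega
    have h := apply_signedPerm (hfix 1 (fun k => flipSign a k * flipSign b k)
      (fun k => by rw [mul_mul_mul_comm, flipSign_mul_self, flipSign_mul_self, one_mul])
      (by rw [Finset.prod_mul_distrib]; simp [flipSign]) rfl
      (by simp [flipSign, hbz.symm, (hk j₁).symm, ha])) t k
    simp only [Equiv.Perm.coe_one, id] at h
    rw [Finset.prod_mul_distrib, prod_flipSign, prod_flipSign, hNa, hNb1] at h
    exact hne (by linarith)
  · obtain rfl : n = 2 := le_antisymm hn2 hn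
    refine hni ⟨rfl, (hbi t k hne).symm.trans ?_⟩
    rw [typeCount, Fintype.card_subtype, Finset.card_filter, Fin.sum_univ_two]
    have h01 : t 0 ≠ t 1 := by
      revert htne hj12
      fin_cases j₁ <;> fin_cases j₂ <;> simp [eq_comm]
    revert h01
    cases t 0 <;> cases t 1 <;> simp

theorem apply_eq_zero_of_not_injective {n i : ℕ} (hn : 2 ≤ n) (hni : ¬ (n = 2 ∧ i = 1))
    {z : Fin n} {α : Phase n [⋀^Fin n]→L[ℝ] ℝ} (hfix : IsFixedBySigned z α)
    (hprim : wedge rfl α (sympForm n) = 0) (hbi : HasBidegree α i) (t : Fin n → Bool)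
    {k : Fin n → Fin n} (hk : ¬ Function.Injective k) :
    α (fun j => basisVec (t j) (k j)) = 0 := by
  have hv := apply_eq_zero_of_forall_ne hn hni hfix hprim hbi
  have hs : ¬ Function.Surjective k := fun h => hk (Finite.injective_iff_surjective.2 h)
  simp only [Function.Surjective, not_forall, not_exists] at hs
  obtain ⟨c, hc⟩ := hs
  by_cases hcz : c = z
  · exact hv t k (hcz ▸ hc)
  · exact apply_eq_zero_of_primitive_of_missing hfix hprim hcz hc (Or.inr hv)

/-! ### Rotation to an axis -/

theorem exists_rotation_to_axis {n : ℕ} (hn : 2 ≤ n) (z : Fin n)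
    (x : EuclideanSpace ℝ (Fin n)) :
    ∃ g ∈ Matrix.specialOrthogonalGroup (Fin n) ℝ,
      Matrix.toEuclideanCLM (n := Fin n) (𝕜 := ℝ) g x = ‖x‖ • EuclideanSpace.single z 1 := by
  by_cases hx : x = 0
  · exact ⟨1, one_mem _, by simp [hx]⟩
  have hx' : ‖x‖ ≠ 0 := norm_ne_zero_iff.2 hx
  obtain ⟨b, hb⟩ := Orthonormal.exists_orthonormalBasis_extension_of_card_eq
    (𝕜 := ℝ) (E := EuclideanSpace ℝ (Fin n)) (ι := Fin n) (by simp)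
    (v := fun _ => ‖x‖⁻¹ • x) (s := {z}) (by
      constructor
      · intro i
        simp [norm_smul, hx']
      · intro i j hij
        exact absurd (Subsingleton.elim i j) hij)
  have hbz : x = ‖x‖ • b z := by rw [hb z rfl, smul_smul, mul_inv_cancel₀ hx', one_smul]
  have : Nontrivial (Fin n) := Fin.nontrivial_iff_two_le.2 hn
  obtain ⟨c, hcz⟩ := exists_ne z
  let g₀ : Matrix (Fin n) (Fin n) ℝ := rowMatrix b
  have hg₀ : g₀ * g₀.transpose = 1 := by
    ext i j
    have h := (orthonormal_iff_ite.1 b.orthonormal) i j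
    rw [PiLp.inner_apply] at h
    simpa [g₀, rowMatrix, Matrix.mul_apply, Matrix.one_apply, mul_comm] using h
  have hdet : g₀.det * g₀.det = 1 := by
    have := congrArg Matrix.det hg₀
    rwa [Matrix.det_mul, Matrix.det_transpose, Matrix.det_one] at this
  -- multiplying one row other than the `z`-th by the determinant makes it equal to one
  let d : Matrix (Fin n) (Fin n) ℝ := Matrix.diagonal fun k => if k = c then g₀.det else 1
  have hd : d * d = 1 := by
    rw [Matrix.diagonal_mul_diagonal, ← Matrix.diagonal_one]
    congr 1
    funext k
    split_ifs
    · exact hdet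
    · simp
  refine ⟨d * g₀, ?_, ?_⟩
  · rw [Matrix.mem_specialOrthogonalGroup_iff, Matrix.mem_orthogonalGroup_iff]
    constructor
    · change d * g₀ * (d * g₀).transpose = 1
      rw [Matrix.transpose_mul, Matrix.diagonal_transpose, Matrix.mul_assoc, ← Matrix.mul_assoc g₀,
        hg₀, Matrix.one_mul]
      exact hd
    · rw [Matrix.det_mul, Matrix.det_diagonal]
      simp [hdet]
  · have h1 : Matrix.toEuclideanCLM (n := Fin n) (𝕜 := ℝ) (d * g₀) (b z) =
        EuclideanSpace.single z 1 := by
      apply PiLp.ext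
      intro j
      have h := (orthonormal_iff_ite.1 b.orthonormal) z j
      rw [PiLp.inner_apply] at h
      rw [Matrix.ofLp_toEuclideanCLM, ← Matrix.mulVec_mulVec, Matrix.mulVec_diagonal]
      have h2 : Matrix.mulVec g₀ (b z).ofLp j = if z = j then 1 else 0 := by
        rw [← h]
        simp [g₀, rowMatrix, Matrix.mulVec, dotProduct]
      rw [h2]
      by_cases hj : z = j
      · subst hj; simp [hcz.symm]
      · simp [hj, Ne.symm hj]
    conv_lhs => rw [hbz]
    rw [map_smul, h1]

/-! ### Coefficients of mixed forms -/

theorem typeCount_eq_sum {d : ℕ} (t : Fin d → Bool) :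
    typeCount t = ∑ j, if t j = true then 1 else 0 := by
  rw [typeCount, Fintype.card_subtype, Finset.card_filter]

theorem typeCount_cons {d : ℕ} (s₀ : Bool) (s : Fin d → Bool) :
    typeCount (Fin.cons s₀ s : Fin (d + 1) → Bool) =
      (if s₀ = true then 1 else 0) + typeCount s := by
  rw [typeCount_eq_sum, typeCount_eq_sum, Fin.sum_univ_succ]
  simp only [Fin.cons_zero, Fin.cons_succ]

theorem typeCount_decide_le (d a : ℕ) :
    typeCount (fun j : Fin d => decide (a ≤ (j : ℕ))) = d - a := by
  induction d generalizing a with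
  | zero => simp [typeCount_eq_sum]
  | succ d ih =>
    rw [typeCount_eq_sum, Fin.sum_univ_castSucc]
    have h := ih a
    rw [typeCount_eq_sum] at h
    simp only [decide_eq_true_eq] at h
    simp only [Fin.val_castSucc, h, Fin.val_last, decide_eq_true_eq]
    split_ifs <;> omega

theorem hasBidegree_wedge {n a b d : ℕ} (h : a + b = d)
    (η : EuclideanSpace ℝ (Fin n) [⋀^Fin a]→L[ℝ] ℝ)
    (l : EuclideanSpace ℝ (Fin n) [⋀^Fin b]→L[ℝ] ℝ) :
    HasBidegree (wedge h (η.compContinuousLinearMap (ContinuousLinearMap.fst ℝ _ _))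
      (l.compContinuousLinearMap (ContinuousLinearMap.snd ℝ _ _)) : Phase n [⋀^Fin d]→L[ℝ] ℝ) b := by
  subst h
  intro t k hne
  rw [wedge_apply] at hne
  obtain ⟨σ, -, hσ⟩ := Finset.exists_ne_zero_of_sum_ne_zero (right_ne_zero_of_mul hne)
  have hσ' := right_ne_zero_of_mul hσ
  rw [tensor_apply] at hσ'
  simp only [ContinuousAlternatingMap.compContinuousLinearMap_apply, Function.comp_def,
    Fin.cast_eq_self] at hσ'
  have h1 : ∀ j, t (σ (Fin.castAdd b j)) = false := by
    intro j
    by_contra hj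
    rw [Bool.not_eq_false] at hj
    exact left_ne_zero_of_mul hσ' (η.map_coord_zero j (by simp [hj, basisVec]))
  have h2 : ∀ j, t (σ (Fin.natAdd a j)) = true := by
    intro j
    by_contra hj
    rw [Bool.not_eq_true] at hj
    exact right_ne_zero_of_mul hσ' (l.map_coord_zero j (by simp [hj, basisVec]))
  rw [← typeCount_comp t σ, typeCount_eq_sum, Fin.sum_univ_add]
  simp [h1, h2]

/-- A form in `Ω^a(ℝⁿ) ⊗ Λ^b ℝⁿ` has smooth coefficients, which depend on `x` only, and bidegree
`(a, b)`. -/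
theorem mixedForms_properties {n a b d : ℕ} (h : a + b = d)
    {w : Phase n → Phase n [⋀^Fin d]→L[ℝ] ℝ} (hw : w ∈ mixedForms n h) :
    (∀ v, ContDiff ℝ ∞ fun x : EuclideanSpace ℝ (Fin n) => w (x, 0) v) ∧
      (∀ p, w p = w (p.1, 0)) ∧ ∀ p, HasBidegree (w p) b := by
  induction hw using Submodule.span_induction with
  | mem w hw =>
    obtain ⟨η, l, hη, rfl⟩ := hw
    refine ⟨fun v => ?_, fun p => rfl, fun p => hasBidegree_wedge h _ _⟩
    simp only [wedge_apply, tensor_apply, ContinuousAlternatingMap.compContinuousLinearMap_apply]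
    refine contDiff_const.mul (ContDiff.sum fun σ _ => contDiff_const.mul
      (ContDiff.mul ?_ contDiff_const))
    exact (ContinuousAlternatingMap.apply ℝ (EuclideanSpace ℝ (Fin n)) ℝ _).contDiff.comp hη
  | zero => exact ⟨fun v => contDiff_const, fun p => rfl, fun p t k hne => absurd rfl hne⟩
  | add w w' _ _ hw hw' =>
    refine ⟨fun v => (hw.1 v).add (hw'.1 v), fun p => ?_, fun p t k hne => ?_⟩
    · rw [Pi.add_apply, Pi.add_apply, ← hw.2.1, ← hw'.2.1]
    · by_cases h0 : w p (fun j => basisVec (t j) (k j)) = 0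
      · refine hw'.2.2 p t k fun h1 => hne ?_
        rw [Pi.add_apply, ContinuousAlternatingMap.add_apply, h0, h1, add_zero]
      · exact hw.2.2 p t k h0
  | smul r w _ hw =>
    refine ⟨fun v => contDiff_const.mul (hw.1 v), fun p => ?_, fun p t k hne => ?_⟩
    · rw [Pi.smul_apply, Pi.smul_apply, ← hw.2.1]
    · exact hw.2.2 p t k (right_ne_zero_of_mul hne)

/-! ### The radial model forms -/

/-- The properties of `γ ∧ τ_i` (for `s₀ = false`) and `β ∧ τ_{i-1}` (for `s₀ = true`) that
characterize their role: invariance, and, on the axis of `e_0`, values on frames of coordinate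
vectors which vanish unless the indices are distinct, `i` vectors have `y`-directions and the type
of `e_0` is `s₀`; in that case the value on the ordered frame is a positive multiple of the squared
radius. -/
structure IsRadialModel {m : ℕ} (s₀ : Bool) (i : ℕ)
    (Θ : Phase (m + 1) → Phase (m + 1) [⋀^Fin (m + 1)]→L[ℝ] ℝ) : Prop where
  invariant : IsSOInvariant Θ
  eq_zero : ∀ (p : Phase (m + 1)) (r : ℝ), p.1 = r • EuclideanSpace.single 0 1 →
    ∀ (t : Fin (m + 1) → Bool) (k : Fin (m + 1) → Fin (m + 1)), ¬ Function.Injective k →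
      Θ p (fun j => basisVec (t j) (k j)) = 0
  typeFrame_eq_zero : ∀ (p : Phase (m + 1)) (r : ℝ), p.1 = r • EuclideanSpace.single 0 1 →
    ∀ t : Fin (m + 1) → Bool, ¬ (t 0 = s₀ ∧ typeCount t = i) → Θ p (typeFrame t) = 0
  exists_pos : ∃ A : ℝ, 0 < A ∧ ∀ (p : Phase (m + 1)) (r : ℝ),
    p.1 = r • EuclideanSpace.single 0 1 → ∀ t : Fin (m + 1) → Bool, t 0 = s₀ → typeCount t = i →
      Θ p (typeFrame t) = r ^ 2 * A

/-- The point `(r e_0, 0)`. -/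
def axisPoint {m : ℕ} (r : ℝ) : Phase (m + 1) := (r • EuclideanSpace.single 0 1, 0)

theorem diagAct_signedPerm_axisPoint {m : ℕ} {ρ : Equiv.Perm (Fin (m + 1))}
    {ε : Fin (m + 1) → ℝ} (hρ : ρ 0 = 0) (r : ℝ) :
    diagAct (signedPerm ρ ε) (axisPoint r) = axisPoint (ε 0 * r) := by
  have h : (axisPoint r : Phase (m + 1)) = r • basisVec false 0 := by
    simp [axisPoint, basisVec]
  rw [h, map_smul, diagAct_signedPerm_basisVec, hρ]
  simp [axisPoint, basisVec, smul_smul, mul_comm]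

theorem IsSOInvariant.isFixedBySigned {m : ℕ}
    {w : Phase (m + 1) → Phase (m + 1) [⋀^Fin (m + 1)]→L[ℝ] ℝ} (hw : IsSOInvariant w) (r : ℝ) :
    IsFixedBySigned 0 (w (axisPoint r)) := by
  intro ρ ε hε hdet hρ hε0
  have h := hw _ (signedPerm_mem hε hdet) (axisPoint r)
  rwa [diagAct_signedPerm_axisPoint hρ, hε0, one_mul] at h

theorem isRadialModel_radialWedge {m : ℕ} (hm : 1 ≤ m) (s₀ : Bool) (s : Fin m → Bool) {i : ℕ}
    (hi : typeCount (Fin.cons s₀ s : Fin (m + 1) → Bool) = i) :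
    IsRadialModel s₀ i (radialWedge s₀ s) where
  invariant := fun _ hg p => radialWedge_comp_diagAct s₀ s p hg
  eq_zero := fun _ _ hp t _ hk => radialWedge_eq_zero s₀ s hp t hk
  typeFrame_eq_zero := fun _ _ hp _ ht => radialWedge_typeFrame_eq_zero hp (by rwa [hi])
  exists_pos := by
    obtain ⟨A, hA, h⟩ := exists_radialWedge_typeFrame_pos (s₀ := s₀) (s := s)
      (t := Fin.cons s₀ s) rfl rfl
    refine ⟨A, hA, fun p r hp t ht0 ht => ?_⟩
    have hfix : IsFixedBySigned 0 (radialWedge s₀ s (axisPoint 1)) :=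
      IsSOInvariant.isFixedBySigned (fun _ hg p => radialWedge_comp_diagAct s₀ s p hg) 1
    obtain ⟨A', -, h'⟩ := exists_radialWedge_typeFrame_pos ht0 (ht.trans hi.symm)
    have h1 := h (axisPoint 1) 1 rfl
    have h1' := h' (axisPoint 1) 1 rfl
    rw [hfix.typeFrame_eq (by omega) (hi.trans ht.symm) (by rw [ht0]; rfl), h1'] at h1
    rw [h' p r hp]
    linear_combination r ^ 2 * h1

theorem IsRadialModel.smul {m i : ℕ} {s₀ : Bool}
    {Θ : Phase (m + 1) → Phase (m + 1) [⋀^Fin (m + 1)]→L[ℝ] ℝ} (h : IsRadialModel s₀ i Θ)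
    {C : ℝ} (hC : 0 < C) : IsRadialModel s₀ i (fun p => C • Θ p) where
  invariant := fun g hg p => by
    ext v
    have := congrArg (fun α => α v) (h.invariant g hg p)
    simpa using congrArg (C * ·) this
  eq_zero := fun p r hp t k hk => by simp [h.eq_zero p r hp t k hk]
  typeFrame_eq_zero := fun p r hp t ht => by
    rw [ContinuousAlternatingMap.smul_apply, h.typeFrame_eq_zero p r hp t ht, smul_zero]
  exists_pos := by
    obtain ⟨A, hA, h'⟩ := h.exists_pos
    refine ⟨C * A, mul_pos hC hA, fun p r hp t h0 ht => ?_⟩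
    rw [ContinuousAlternatingMap.smul_apply, h' p r hp t h0 ht, smul_eq_mul]
    ring

/-- The zero form is a radial model if no type pattern exists. -/
theorem isRadialModel_zero {m i : ℕ} {s₀ : Bool}
    (h : ∀ t : Fin (m + 1) → Bool, t 0 = s₀ → typeCount t ≠ i) :
    IsRadialModel s₀ i (0 : Phase (m + 1) → Phase (m + 1) [⋀^Fin (m + 1)]→L[ℝ] ℝ) where
  invariant := fun _ _ _ => rfl
  eq_zero := fun _ _ _ _ _ _ => rfl
  typeFrame_eq_zero := fun _ _ _ _ _ => rfl
  exists_pos := ⟨1, one_pos, fun _ _ _ t h0 ht => absurd ht (h t h0)⟩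

/-! ### The classification -/

/-- The coefficient of an invariant form on a frame of given type, as a function of the position on
the axis, is even and therefore its variation is a smooth multiple of the value of the radial
model. -/
theorem exists_radial_coefficient {m i : ℕ} (hm : 1 ≤ m)
    {w Θ : Phase (m + 1) → Phase (m + 1) [⋀^Fin (m + 1)]→L[ℝ] ℝ} {s₀ : Bool}
    (hsmooth : ∀ v, ContDiff ℝ ∞ fun x : EuclideanSpace ℝ (Fin (m + 1)) => w (x, 0) v)
    (hinv : IsSOInvariant w) (hΘ : IsRadialModel s₀ i Θ) :
    ∃ f : ℝ → ℝ, ContDiffOn ℝ ∞ f (Set.Ici 0) ∧ ∀ (p : Phase (m + 1)) (r : ℝ), 0 ≤ r →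
      p.1 = r • EuclideanSpace.single 0 1 → ∀ t : Fin (m + 1) → Bool, t 0 = s₀ →
        typeCount t = i → w (axisPoint r) (typeFrame t) =
          w (axisPoint 0) (typeFrame t) + f (r ^ 2) * Θ p (typeFrame t) := by
  by_cases ht : ∃ t : Fin (m + 1) → Bool, t 0 = s₀ ∧ typeCount t = i
  swap
  · push Not at ht
    exact ⟨0, contDiffOn_const, fun _ _ _ _ t h0 h1 => absurd h1 (ht t h0)⟩
  obtain ⟨t₁, ht₁0, ht₁⟩ := ht
  have hFsmooth : ContDiff ℝ ∞ fun r : ℝ => w (axisPoint r) (typeFrame t₁) :=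
    (hsmooth (typeFrame t₁)).comp (contDiff_id.smul contDiff_const)
  -- the diagonal matrix with entry `-1` at `0` and `m` and `1` elsewhere reverses the axis
  have hFeven : ∀ r : ℝ, w (axisPoint (-r)) (typeFrame t₁) = w (axisPoint r) (typeFrame t₁) := by
    intro r
    have hl : (0 : Fin (m + 1)) ≠ Fin.last m := fun h => by
      have := congrArg Fin.val h
      simp at this
      omega
    have hdet : (∏ k : Fin (m + 1), flipSign 0 k * flipSign (Fin.last m) k) *
        ((Equiv.Perm.sign (1 : Equiv.Perm (Fin (m + 1))) : ℤ) : ℝ) = 1 := by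
      rw [Finset.prod_mul_distrib]; simp [flipSign]
    have h := hinv _ (signedPerm_mem (fun k => by
      rw [mul_mul_mul_comm, flipSign_mul_self, flipSign_mul_self, one_mul]) hdet) (axisPoint r)
    rw [diagAct_signedPerm_axisPoint rfl] at h
    have h2 := typeFrame_comp_of_fixed hdet h t₁
    have h3 : flipSign (0 : Fin (m + 1)) 0 * flipSign (Fin.last m) 0 * r = -r := by
      simp [flipSign, hl]
    rw [h3] at h2
    exact h2.symm
  obtain ⟨f, hf, hfF⟩ := exists_eq_add_sq_mul_of_even hFsmooth hFeven
  obtain ⟨A, hA, hΘA⟩ := hΘ.exists_pos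
  refine ⟨fun s => A⁻¹ * f s, contDiffOn_const.mul hf, fun p r hr hp t h0 h1 => ?_⟩
  have hfix := fun r => IsSOInvariant.isFixedBySigned hinv r
  rw [hΘA p r hp t h0 h1,
    (hfix r).typeFrame_eq (by omega) (h1.trans ht₁.symm) (h0.trans ht₁0.symm),
    (hfix 0).typeFrame_eq (by omega) (h1.trans ht₁.symm) (h0.trans ht₁0.symm), hfF r hr]
  field_simp

/-- The classification in terms of abstract models: the three forms are compared with `w` on frames
of coordinate vectors at points of the axis, and the equality is carried to other points by a
rotation. -/
theorem exists_eq_models {m i : ℕ} (hm : 1 ≤ m) (hmi : ¬ (m + 1 = 2 ∧ i = 1))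
    {w Θ₁ Θ₂ : Phase (m + 1) → Phase (m + 1) [⋀^Fin (m + 1)]→L[ℝ] ℝ}
    (hsmooth : ∀ v, ContDiff ℝ ∞ fun x : EuclideanSpace ℝ (Fin (m + 1)) => w (x, 0) v)
    (hdep : ∀ p, w p = w (p.1, 0)) (hbi : ∀ p, HasBidegree (w p) i)
    (hprim : IsPrimitive w) (hinv : IsSOInvariant w) {s : Fin (m + 1) → Bool}
    (hs : typeCount s = i) (hΘ₁ : IsRadialModel false i Θ₁) (hΘ₂ : IsRadialModel true i Θ₂) :
    ∃ (c : ℝ) (f₁ f₂ : ℝ → ℝ), ContDiffOn ℝ ∞ f₁ (Set.Ici 0) ∧ ContDiffOn ℝ ∞ f₂ (Set.Ici 0) ∧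
      ∀ p, w p = c • alternant s + f₁ (‖p.1‖ ^ 2) • Θ₁ p + f₂ (‖p.1‖ ^ 2) • Θ₂ p := by
  obtain ⟨f₁, hf₁, h₁⟩ := exists_radial_coefficient hm hsmooth hinv hΘ₁
  obtain ⟨f₂, hf₂, h₂⟩ := exists_radial_coefficient hm hsmooth hinv hΘ₂
  let c : ℝ := w (axisPoint 0) (typeFrame s) / alternant s (typeFrame s)
  have hspos : 0 < alternant s (typeFrame s) := alternant_typeFrame_pos rfl
  -- at the origin the whole group `SO(n)` acts, so the value does not depend on the type of `e_0`
  have hc : ∀ t, typeCount t = i →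
      w (axisPoint 0) (typeFrame t) = c * alternant s (typeFrame t) := by
    intro t ht
    obtain ⟨ρ, rfl⟩ := exists_perm_comp_eq (hs.trans ht.symm)
    have hdet : (∏ k, fixSign ρ 0 k) * ((Equiv.Perm.sign ρ : ℤ) : ℝ) = 1 := by
      rw [prod_fixSign, sign_mul_self_cast]
    have h := hinv _ (fixSign_mem ρ 0) (axisPoint 0)
    have h0 : (axisPoint 0 : Phase (m + 1)) = 0 := by simp [axisPoint]
    rw [h0, map_zero, ← h0] at h
    rw [typeFrame_comp_of_fixed hdet h,
      typeFrame_comp_of_fixed hdet (alternant_comp_diagAct s (fixSign_mem ρ 0))]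
    exact (div_mul_cancel₀ _ hspos.ne').symm
  have haxis : ∀ (p : Phase (m + 1)) (r : ℝ), 0 ≤ r → p.1 = r • EuclideanSpace.single 0 1 →
      w p = c • alternant s + f₁ (r ^ 2) • Θ₁ p + f₂ (r ^ 2) • Θ₂ p := by
    intro p r hr hp
    have hwp : w p = w (axisPoint r) := by rw [hdep, hp]; rfl
    refine ext_basisVec fun t k => ?_
    by_cases hk : Function.Injective k
    swap
    · rw [hwp, apply_eq_zero_of_not_injective (by omega) hmi
        (IsSOInvariant.isFixedBySigned hinv r) (hprim _) (hbi _) t hk]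
      simp only [ContinuousAlternatingMap.add_apply, ContinuousAlternatingMap.smul_apply,
        alternant_eq_zero s t hk, hΘ₁.eq_zero p r hp t k hk, hΘ₂.eq_zero p r hp t k hk, smul_zero,
        add_zero]
    obtain ⟨π, rfl⟩ : ∃ π : Equiv.Perm (Fin (m + 1)), k = π :=
      ⟨Equiv.ofBijective k (Finite.injective_iff_bijective.1 hk), rfl⟩
    rw [apply_perm_eq, apply_perm_eq]
    congr 1
    generalize t ∘ π.symm = t
    simp only [ContinuousAlternatingMap.add_apply, ContinuousAlternatingMap.smul_apply,
      smul_eq_mul]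
    by_cases ht : typeCount t = i
    swap
    · rw [alternant_typeFrame_eq_zero (by rwa [hs]),
        hΘ₁.typeFrame_eq_zero p r hp t fun h => ht h.2,
        hΘ₂.typeFrame_eq_zero p r hp t fun h => ht h.2]
      by_contra h
      exact ht (hbi p t id fun h' => h (by simpa using h'))
    cases h0 : t 0
    · rw [hΘ₂.typeFrame_eq_zero p r hp t (by simp [h0]), hwp, h₁ p r hr hp t h0 ht, hc t ht]
      ring
    · rw [hΘ₁.typeFrame_eq_zero p r hp t (by simp [h0]), hwp, h₂ p r hr hp t h0 ht, hc t ht]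
      ring
  refine ⟨c, f₁, f₂, hf₁, hf₂, fun p => ?_⟩
  obtain ⟨g, hg, hgp⟩ := exists_rotation_to_axis (by omega : 2 ≤ m + 1) 0 p.1
  have h := haxis (diagAct g p) ‖p.1‖ (norm_nonneg _) hgp
  rw [← hinv g hg p, h]
  conv_rhs => rw [← alternant_comp_diagAct s hg, ← hΘ₁.invariant g hg p, ← hΘ₂.invariant g hg p]
  rfl

/-! ### Identification of the model forms -/

theorem wedge_smul_right {E : Type*} [NormedAddCommGroup E] [NormedSpace ℝ E] {a b d : ℕ}
    (h : a + b = d) (α : E [⋀^Fin a]→L[ℝ] ℝ) (C : ℝ) (β : E [⋀^Fin b]→L[ℝ] ℝ) :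
    wedge h α (C • β) = C • wedge h α β := by
  ext v
  simp only [wedge_apply, tensor_apply, ContinuousAlternatingMap.smul_apply, smul_eq_mul,
    Finset.mul_sum]
  exact Finset.sum_congr rfl fun _ _ => by ring

theorem ite_dx_dy_eq_coord {n a b : ℕ} (k : Fin n) :
    (if b < a then dx k else dy k) = coord (decide (a ≤ b)) k := by
  by_cases h : b < a
  · rw [if_pos h, decide_eq_false (by omega), coord_false]
  · rw [if_neg h, decide_eq_true (by omega), coord_true]

theorem kappaForm_eq (n i : ℕ) :
    kappaForm n i = ((i ! : ℝ) * ((n - i)! : ℝ))⁻¹ •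
      alternant fun j : Fin n => decide (n - i ≤ (j : ℕ)) := by
  simp only [kappaForm, alternant, ite_dx_dy_eq_coord]

theorem tauForm_eq {m a : ℕ} (hm : 0 < m + 1) (ha : a ≤ m) (p : Phase (m + 1)) :
    tauForm hm (a : ℤ) p = ((a ! : ℝ) * ((m + 1 - a)! : ℝ))⁻¹ •
      radialAlternant (fun j : Fin m => decide (m - a ≤ (j : ℕ))) p := by
  have h : ∀ j : ℕ, decide (m - a ≤ j) = decide (m + 1 - a ≤ j + 1) := fun j => by
    rw [decide_eq_decide]; omega
  rw [tauForm, if_pos (by omega)]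
  simp only [Int.toNat_natCast, radialAlternant, ite_dx_dy_eq_coord, h]
  rfl

theorem isRadialModel_gammaForm_tauForm {m i : ℕ} (hm : 1 ≤ m) (hi : i ≤ m + 1)
    (h : 1 + (m + 1 - 1) = m + 1) (h' : 0 < m + 1) :
    IsRadialModel false i
      (fun p : Phase (m + 1) => wedge h (gammaForm p) (tauForm h' (i : ℤ) p)) := by
  rcases Nat.lt_or_ge m i with him | him
  · have h0 : (fun p : Phase (m + 1) => wedge h (gammaForm p) (tauForm h' (i : ℤ) p)) = 0 := by
      funext p
      rw [tauForm, if_neg (by omega), wedge_zero]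
      rfl
    rw [h0]
    refine isRadialModel_zero fun t ht0 ht => ?_
    -- only `m` positions are left for the `i = m + 1` directions `y`
    have h1 : ∑ j : Fin m, (if t j.succ = true then 1 else 0) ≤ ∑ _j : Fin m, 1 :=
      Finset.sum_le_sum fun j _ => by split_ifs <;> simp
    rw [typeCount_eq_sum, Fin.sum_univ_succ, ht0] at ht
    simp at h1 ht
    omega
  · have h0 : (fun p : Phase (m + 1) => wedge h (gammaForm p) (tauForm h' (i : ℤ) p)) =
        fun p => ((i ! : ℝ) * ((m + 1 - i)! : ℝ))⁻¹ •
          radialWedge false (fun j : Fin m => decide (m - i ≤ (j : ℕ))) p := by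
      funext p
      rw [tauForm_eq h' him]
      exact wedge_smul_right _ _ _ _
    rw [h0]
    refine IsRadialModel.smul (isRadialModel_radialWedge hm _ _ ?_) (by positivity)
    rw [typeCount_cons, typeCount_decide_le]
    simp
    omega

theorem isRadialModel_betaForm_tauForm {m i : ℕ} (hm : 1 ≤ m) (hi : i ≤ m + 1)
    (h : 1 + (m + 1 - 1) = m + 1) (h' : 0 < m + 1) :
    IsRadialModel true i
      (fun p : Phase (m + 1) => wedge h (betaForm p) (tauForm h' ((i : ℤ) - 1) p)) := by
  rcases i with _ | i
  · have h0 : (fun p : Phase (m + 1) =>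
        wedge h (betaForm p) (tauForm h' (((0 : ℕ) : ℤ) - 1) p)) = 0 := by
      funext p
      rw [tauForm, if_neg (by omega), wedge_zero]
      rfl
    rw [h0]
    refine isRadialModel_zero fun t ht0 ht => ?_
    rw [typeCount_eq_sum, Fin.sum_univ_succ, ht0] at ht
    simp at ht
  · have h0 : (fun p : Phase (m + 1) =>
        wedge h (betaForm p) (tauForm h' (((i + 1 : ℕ) : ℤ) - 1) p)) =
        fun p => ((i ! : ℝ) * ((m + 1 - i)! : ℝ))⁻¹ •
          radialWedge true (fun j : Fin m => decide (m - i ≤ (j : ℕ))) p := by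
      funext p
      rw [show (((i + 1 : ℕ) : ℤ) - 1) = (i : ℤ) by omega, tauForm_eq h' (by omega)]
      exact wedge_smul_right _ _ _ _
    rw [h0]
    refine IsRadialModel.smul (isRadialModel_radialWedge hm _ _ ?_) (by positivity)
    rw [typeCount_cons, typeCount_decide_le]
    simp
    omega

end InvForms

end

theorem mainTheorem5 (n i : ℕ) (hn : 2 ≤ n) (hi : i ≤ n) (hni : ¬ (n = 2 ∧ i = 1))
    (w : InvForms.Phase n → InvForms.Phase n [⋀^Fin n]→L[ℝ] ℝ)
    (hw : w ∈ InvForms.mixedForms n (Nat.sub_add_cancel hi : n - i + i = n))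
    (hprim : InvForms.IsPrimitive w) (hinv : InvForms.IsSOInvariant w) :
    ∃ (c : ℝ) (φ₁ φ₂ : ℝ → ℝ),
      ContDiffOn ℝ ∞ φ₁ (Set.Ici 0) ∧ ContDiffOn ℝ ∞ φ₂ (Set.Ici 0) ∧
      ∀ p : InvForms.Phase n,
        w p = c • InvForms.kappaForm n i
          + φ₁ (‖p.1‖ ^ 2) • InvForms.wedge (by omega : 1 + (n - 1) = n)
              (InvForms.gammaForm p) (InvForms.tauForm (by omega : 0 < n) (i : ℤ) p)
          + φ₂ (‖p.1‖ ^ 2) • InvForms.wedge (by omega : 1 + (n - 1) = n)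
              (InvForms.betaForm p) (InvForms.tauForm (by omega : 0 < n) ((i : ℤ) - 1) p) := by
  obtain ⟨hsmooth, hdep, hbi⟩ := InvForms.mixedForms_properties _ hw
  obtain ⟨m, rfl⟩ : ∃ m, n = m + 1 := ⟨n - 1, by omega⟩
  have hs : InvForms.typeCount (fun j : Fin (m + 1) => decide (m + 1 - i ≤ (j : ℕ))) = i := by
    rw [InvForms.typeCount_decide_le]
    omega
  obtain ⟨c, φ₁, φ₂, h₁, h₂, h⟩ := InvForms.exists_eq_models (by omega) hni hsmooth hdep hbi
    hprim hinv hs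
    (InvForms.isRadialModel_gammaForm_tauForm (by omega) hi (by omega) (by omega))
    (InvForms.isRadialModel_betaForm_tauForm (by omega) hi (by omega) (by omega))
  refine ⟨c * ((i ! : ℝ) * ((m + 1 - i)! : ℝ)), φ₁, φ₂, h₁, h₂, fun p => ?_⟩
  rw [h p, InvForms.kappaForm_eq, smul_smul, mul_assoc, mul_inv_cancel₀ (by positivity), mul_one]
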